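/- All graphs are finite and simple. For a graph $G$ with $n$ vertices let $\chi_G(x)$ be the characteristic polynomial of its adjacency matrix. The Mahler measure $M(P)$ of a monic polynomial $P(z)=\prod_i(z-\alpha_i)\in\mathbb{C}[z]$ is $\prod_i\max(1,|\alpha_i|)$, and the Mahler measure of $G$ is $M(G):=M\bigl(z^n\chi_G(z+1/z)\bigr)$. For $a,b,c\ge 1$ let $T(a,b,c)$ be the tree with $a+b+c+1$ vertices that consists of a central vertex to which three disjoint paths, with $a$, $b$ and $c$ vertices, are each attached by one of their end vertices. Let $\tau_1=1.176280818\cdots$ be the largest real zero of Lehmer's polynomial $$L(z)=z^{10}+z^9-z^7-z^6-z^5-z^4-z^3+z+1 .$$ **Corollary (Lehmer's conjecture for graphs).** For every graph $G$, either $M(G)=1$ or $M(G)\ge\tau_1$. Moreover $M(T(1,2,6))=\tau_1$, and a connected graph $G$ has $M(G)=\tau_1$ if and only if $G$ is isomorphic to $T(1,2,6)$. This graph is the Coxeter graph $E_{10}$ (a path on nine vertices together with a tenth vertex joined to the third vertex of the path). -/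

import Mathlib

namespace GraphMahler

open Polynomial

/-- The characteristic polynomial of a finite simple graph: that of its adjacency matrix. -/
noncomputable def charPoly {V : Type*} [Fintype V] (G : SimpleGraph V) : ℤ[X] := by
  classical exact (G.adjMatrix ℤ).charpoly

/-- For a polynomial `P` and a natural number `n ≥ deg P`, the polynomial `z ^ n * P (z + 1 / z)`,
written without denominators: `∑ p_k (z ^ 2 + 1) ^ k z ^ (n - k)`. -/
noncomputable def jouk (n : ℕ) (P : ℤ[X]) : ℤ[X] :=
  ∑ k ∈ Finset.range (n + 1), C (P.coeff k) * (X ^ 2 + 1) ^ k * X ^ (n - k)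

/-- `jouk n P` is indeed `z ^ n * P (z + 1 / z)`. -/
theorem aeval_jouk (n : ℕ) (P : ℤ[X]) (hP : P.natDegree ≤ n) (z : ℂ) (hz : z ≠ 0) :
    aeval z (jouk n P) = z ^ n * aeval (z + 1 / z) P := by
  rw [aeval_eq_sum_range' (Nat.lt_succ_of_le hP), jouk, map_sum, Finset.mul_sum]
  refine Finset.sum_congr rfl fun k hk => ?_
  have hk' : k ≤ n := Nat.lt_succ_iff.mp (Finset.mem_range.mp hk)
  have h1 : z ^ n = z ^ (n - k) * z ^ k := by rw [← pow_add, Nat.sub_add_cancel hk']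
  have h2 : z ^ 2 + 1 = z * (z + 1 / z) := by field_simp
  simp only [map_mul, map_pow, map_add, map_one, aeval_X, zsmul_eq_mul,
    eq_intCast, map_intCast, h1, h2, mul_pow]
  ring

/-- The Mahler measure of an `n`-vertex graph `G`: the Mahler measure of the polynomial
`z ^ n * χ_G (z + 1 / z)`. -/
noncomputable def mahler {V : Type*} [Fintype V] (G : SimpleGraph V) : ℝ :=
  (jouk (Fintype.card V) (charPoly G)).mapMahlerMeasure (Int.castRingHom ℂ)

/-- Lehmer's polynomial. -/
noncomputable def lehmerPoly : ℤ[X] :=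
  X ^ 10 + X ^ 9 - X ^ 7 - X ^ 6 - X ^ 5 - X ^ 4 - X ^ 3 + X + 1

/-- The starlike tree `T(a, b, c)`: a central vertex `none` with three pendant paths ("arms")
attached to it, having `a`, `b` and `c` vertices. The vertex `some ⟨i, k⟩` is the one at
distance `k + 1` from the centre on the `i`-th arm. -/
def T (a b c : ℕ) : SimpleGraph (Option (Σ i : Fin 3, Fin (![a, b, c] i))) :=
  SimpleGraph.fromRel fun u v =>
    match u, v with
    | none, some ⟨_, k⟩ => k.val = 0
    | some ⟨i, k⟩, some ⟨j, l⟩ => i = j ∧ k.val + 1 = l.val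
    | _, none => False

/-- The Coxeter graph `E_n`: a path on the vertices `0, 1, …, n - 2`, together with one further
vertex `n - 1` that is joined to the third vertex `2` of the path. -/
def E (n : ℕ) : SimpleGraph (Fin n) :=
  SimpleGraph.fromRel fun i j =>
    (i.val + 1 = j.val ∧ j.val + 1 < n) ∨ (i.val = 2 ∧ j.val + 1 = n)

end GraphMahler

/-! ### Mahler measure as a product over eigenvalues, and quadratic form bounds. -/

namespace GraphMahler

open Polynomial
open scoped Classical

/-! If `μ` runs over the eigenvalues of `G`, then `z ^ n * χ (z + 1 / z)` is the product of the `z ^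
2 - μ z + 1`. Hence `M(G)` is a product of factors `≥ 1`, namely `1` when `|μ| ≤ 2` and `s` when
`|μ| = s + 1 / s` with `s ≥ 1` (`exists_spectral`). Only eigenvalues outside `[-2, 2]` matter. A
positive `w` with `A w ≤ 2 w` excludes them, so `M(G) = 1`. A nonzero `x ≥ 0` with `A x ≥ l x`
forces an eigenvalue `≥ l` and, if `G` is bipartite, another one `≤ -l`.

Two thresholds suffice: `61/30 = 6/5 + 5/6` gives `M ≥ 6/5`, and `265/132 = 12/11 + 11/12`, reached
at both ends of the spectrum, gives `M ≥ (12/11)^2 > 1.19`. Both exceed `τ₁`.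

The heart is `connected_cases`. Weight `2` on vertices of degree at least two and `1` elsewhere
works as `w`, unless some vertex has degree plus number of non-leaf neighbours at least `5`. At such
a vertex, degree at least `4`, or a cycle in the graph, leads to `61/30`. Otherwise the graph is a
tree and the degree is `3`: a second vertex of degree at least `3` leads to `265/132`, and without
one the graph is some `T a b c`. Comparison with the affine diagrams `T 2 2 2`, `T 1 3 3`, `T 1 2 5`
then leaves only `T 1 2 6` (`T_cases`).

For `T 1 2 6`, the condition that `√τ + 1 / √τ` be the largest eigenvalue becomes Lehmer's equation
for `τ` (`armRatio_sum_of_lehmer`). Deleting the centre leaves paths, so at most one eigenvalue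
exceeds `2` and at most one is below `-2`; thus `M = (√τ)^2 = τ`. A general graph is treated through
its components. -/

/-- The quadratic form of the adjacency matrix. -/
noncomputable def adjForm {V : Type*} [Fintype V] (G : SimpleGraph V) (x : V → ℝ) : ℝ :=
  ∑ u, ∑ v, if G.Adj u v then x u * x v else 0

/-- The Mahler measure of `X ^ 2 - μ * X + 1` for real `μ`. -/
noncomputable def quadMahler (μ : ℝ) : ℝ :=
  if |μ| ≤ 2 then 1 else (|μ| + √(μ ^ 2 - 4)) / 2

theorem one_le_quadMahler (μ : ℝ) : 1 ≤ quadMahler μ := by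
  unfold quadMahler
  split_ifs with h
  · rfl
  · have := Real.sqrt_nonneg (μ ^ 2 - 4)
    linarith

theorem quadMahler_of_abs_le {μ : ℝ} (h : |μ| ≤ 2) : quadMahler μ = 1 := if_pos h

theorem quadMahler_mono {μ ν : ℝ} (h : |μ| ≤ |ν|) : quadMahler μ ≤ quadMahler ν := by
  by_cases hμ : |μ| ≤ 2
  · rw [quadMahler_of_abs_le hμ]; exact one_le_quadMahler ν
  · have hν : ¬ |ν| ≤ 2 := fun h' => hμ (h.trans h')
    rw [quadMahler, quadMahler, if_neg hμ, if_neg hν]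
    have : μ ^ 2 ≤ ν ^ 2 := sq_le_sq.mpr h
    have := Real.sqrt_le_sqrt (sub_le_sub_right this 4)
    linarith

theorem quadMahler_neg (μ : ℝ) : quadMahler (-μ) = quadMahler μ := by
  simp [quadMahler]

theorem quadMahler_add_inv {s : ℝ} (hs : 1 ≤ s) : quadMahler (s + 1 / s) = s := by
  have hs0 : 0 < s := by linarith
  have h1 : 0 ≤ s - 1 / s := by
    have : 1 / s ≤ 1 := by rw [div_le_one hs0]; exact hs
    linarith
  have h2 : |s + 1 / s| = s + 1 / s := abs_of_pos (by positivity)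
  have h3 : (s + 1 / s) ^ 2 - 4 = (s - 1 / s) ^ 2 := by field_simp; ring
  rw [quadMahler, h2, h3, Real.sqrt_sq h1]
  split_ifs with h
  · have h4 : (s - 1) ^ 2 ≤ 0 := by
      have h5 : s * (s + 1 / s) = s ^ 2 + 1 := by field_simp
      nlinarith
    have := pow_eq_zero_iff (two_ne_zero) |>.mp (le_antisymm h4 (sq_nonneg _))
    linarith
  · ring

theorem mahlerMeasure_mul_X_sub_C_of_mul_eq_one {z w : ℂ} (h : z * w = 1) (hz : 1 ≤ ‖z‖) :
    ((X - C z) * (X - C w)).mahlerMeasure = ‖z‖ := by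
  have hw : ‖w‖ ≤ 1 := by
    have : ‖z‖ * ‖w‖ = 1 := by rw [← norm_mul, h, norm_one]
    nlinarith [norm_nonneg w]
  rw [mahlerMeasure_mul, mahlerMeasure_X_sub_C, mahlerMeasure_X_sub_C, max_eq_right hz,
    max_eq_left hw, mul_one]

theorem X_sub_C_mul_X_sub_C_eq {z w μ : ℂ} (h : z * w = 1) (h' : z + w = μ) :
    (X - C z) * (X - C w) = (X ^ 2 + 1 - C μ * X : ℂ[X]) := by
  have h1 : (C z * C w : ℂ[X]) = 1 := by rw [← C_mul, h, C_1]
  have h2 : (C z + C w : ℂ[X]) = C μ := by rw [← C_add, h']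
  linear_combination h1 - X * h2

theorem mahlerMeasure_quad (μ : ℝ) :
    (X ^ 2 + 1 - C (μ : ℂ) * X : ℂ[X]).mahlerMeasure = quadMahler μ := by
  rw [quadMahler]
  split_ifs with h
  · have h4 : 0 ≤ 1 - (μ / 2) ^ 2 := by
      have := abs_le.mp h
      nlinarith
    set z : ℂ := ⟨μ / 2, √(1 - (μ / 2) ^ 2)⟩ with hz
    have hn : ‖z‖ = 1 := by
      have : ‖z‖ ^ 2 = 1 := by
        rw [Complex.sq_norm, Complex.normSq_apply]
        simp only [hz]
        rw [Real.mul_self_sqrt h4]; ring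
      nlinarith [norm_nonneg z]
    have hzw : z * (starRingEnd ℂ) z = 1 := by
      rw [Complex.mul_conj, Complex.normSq_eq_norm_sq, hn]; simp
    have hs : z + (starRingEnd ℂ) z = (μ : ℂ) := by
      rw [Complex.add_conj]; simp [hz, mul_div_cancel₀]
    rw [← X_sub_C_mul_X_sub_C_eq hzw hs, mahlerMeasure_mul_X_sub_C_of_mul_eq_one hzw hn.ge, hn]
  · have hd : 0 ≤ μ ^ 2 - 4 := by
      rw [← sq_abs]; nlinarith
    -- `ε` is a sign of `μ`; the roots are the real numbers `ε (|μ| ± r) / 2`, whose product is `1`.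
    have key : ∀ ε : ℝ, ε ^ 2 = 1 → ε * μ = |μ| →
        (X ^ 2 + 1 - C (μ : ℂ) * X : ℂ[X]).mahlerMeasure = (|μ| + √(μ ^ 2 - 4)) / 2 := by
      intro ε hε hεμ
      have hsq := Real.mul_self_sqrt hd
      have hμ : μ = ε * |μ| := by rw [← hεμ, ← mul_assoc, ← sq, hε, one_mul]
      set r := √(μ ^ 2 - 4) with hr
      have hr0 : 0 ≤ r := Real.sqrt_nonneg _
      have hzw : ((ε * ((|μ| + r) / 2) : ℝ) : ℂ) * ((ε * ((|μ| - r) / 2) : ℝ) : ℂ) = 1 := by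
        rw [← Complex.ofReal_mul]
        norm_cast
        have := sq_abs μ
        linear_combination (ε ^ 2 / 4) * (this - hsq) + hε
      have hs : ((ε * ((|μ| + r) / 2) : ℝ) : ℂ) + ((ε * ((|μ| - r) / 2) : ℝ) : ℂ) = (μ : ℂ) := by
        rw [← Complex.ofReal_add]
        norm_cast
        linear_combination -hμ
      have hab : |ε| = 1 := by
        have := sq_abs ε
        nlinarith [abs_nonneg ε]
      have hn : ‖((ε * ((|μ| + r) / 2) : ℝ) : ℂ)‖ = (|μ| + r) / 2 := by
        rw [Complex.norm_real, norm_mul, Real.norm_eq_abs, hab, one_mul, Real.norm_eq_abs,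
          abs_of_nonneg (by positivity)]
      rw [← X_sub_C_mul_X_sub_C_eq hzw hs, mahlerMeasure_mul_X_sub_C_of_mul_eq_one hzw, hn]
      rw [hn]; linarith
    rcases le_total 0 μ with h0 | h0
    · exact key 1 (by norm_num) (by rw [abs_of_nonneg h0, one_mul])
    · exact key (-1) (by norm_num) (by rw [abs_of_nonpos h0]; ring)

theorem mahlerMeasure_prod {ι : Type*} (s : Finset ι) (f : ι → ℂ[X]) :
    (∏ i ∈ s, f i).mahlerMeasure = ∏ i ∈ s, (f i).mahlerMeasure := by
  induction s using Finset.induction_on with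
  | empty => simp
  | insert a s ha ih => rw [Finset.prod_insert ha, Finset.prod_insert ha, mahlerMeasure_mul, ih]

theorem map_jouk_eq_prod {ι : Type*} [Fintype ι] {P : ℤ[X]} {μ : ι → ℝ}
    (hP : P.map (Int.castRingHom ℂ) = ∏ i, (X - C (μ i : ℂ))) :
    (jouk (Fintype.card ι) P).map (Int.castRingHom ℂ) = ∏ i, (X ^ 2 + 1 - C (μ i : ℂ) * X) := by
  have hdeg : P.natDegree ≤ Fintype.card ι := by
    rw [← natDegree_map_eq_of_injective (f := Int.castRingHom ℂ) Int.cast_injective, hP,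
      natDegree_prod_of_monic _ _ fun i _ => monic_X_sub_C _]
    simp
  -- `aeval_jouk` requires `z ≠ 0`, so the two sides are compared at the infinitely many other
  -- points.
  refine eq_of_infinite_eval_eq _ _ (Set.Infinite.mono (s := {0}ᶜ) ?_
    (Set.finite_singleton (0 : ℂ)).infinite_compl)
  intro z hz
  have hz : z ≠ 0 := hz
  have h1 := aeval_jouk _ P hdeg z hz
  have h2 : aeval (z + 1 / z) P = ∏ i, (z + 1 / z - (μ i : ℂ)) := by
    rw [← eval_map_algebraMap, show algebraMap ℤ ℂ = Int.castRingHom ℂ from rfl, hP, eval_prod]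
    simp
  change eval z _ = eval z _
  rw [show Int.castRingHom ℂ = algebraMap ℤ ℂ from rfl, eval_map_algebraMap, h1, h2, eval_prod,
    ← Finset.card_univ, ← Finset.prod_const, ← Finset.prod_mul_distrib]
  refine Finset.prod_congr rfl fun i _ => ?_
  simp only [eval_sub, eval_add, eval_pow, eval_X, eval_one, eval_mul, eval_C]
  field_simp

/-- The spectral theorem in the only form used later: `c` takes coordinates in an orthonormal
eigenbasis, so it preserves the norm and diagonalises the form. -/
theorem exists_spectral {V : Type*} [Fintype V] (G : SimpleGraph V) :
    ∃ (μ : V → ℝ) (c : (V → ℝ) ≃ₗ[ℝ] (V → ℝ)),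
      (∀ x, ∑ i, c x i ^ 2 = ∑ i, x i ^ 2) ∧ (∀ x, adjForm G x = ∑ i, μ i * c x i ^ 2) ∧
      mahler G = ∏ i, quadMahler (μ i) := by
  have hA : (G.adjMatrix ℝ).IsHermitian := by
    rw [Matrix.IsHermitian, Matrix.conjTranspose_eq_transpose_of_trivial]
    exact SimpleGraph.transpose_adjMatrix G
  refine ⟨hA.eigenvalues, (WithLp.linearEquiv 2 ℝ (V → ℝ)).symm ≪≫ₗ
    hA.eigenvectorBasis.repr.toLinearEquiv ≪≫ₗ WithLp.linearEquiv 2 ℝ (V → ℝ), ?_, ?_, ?_⟩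
  · intro x
    have := hA.eigenvectorBasis.repr.norm_map (WithLp.toLp 2 x)
    have h2 : ‖hA.eigenvectorBasis.repr (WithLp.toLp 2 x)‖ ^ 2 = ‖WithLp.toLp 2 x‖ ^ 2 := by
      rw [this]
    simp only [EuclideanSpace.real_norm_sq_eq] at h2
    exact h2
  · intro x
    set c : V → ℝ := fun i => hA.eigenvectorBasis.repr (WithLp.toLp 2 x) i with hc
    have hx : x = ∑ i, c i • (hA.eigenvectorBasis i).ofLp := by
      have := congrArg WithLp.ofLp (hA.eigenvectorBasis.sum_repr (WithLp.toLp 2 x))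
      simpa using this.symm
    have hci : ∀ i, x ⬝ᵥ (hA.eigenvectorBasis i).ofLp = c i := by
      intro i
      simp only [hc, OrthonormalBasis.repr_apply_apply, EuclideanSpace.inner_eq_star_dotProduct,
        star_trivial]
    have h1 : adjForm G x = x ⬝ᵥ ((G.adjMatrix ℝ).mulVec x) := by
      simp only [adjForm, dotProduct, Matrix.mulVec, SimpleGraph.adjMatrix_apply, Finset.mul_sum]
      refine Finset.sum_congr rfl fun u _ => Finset.sum_congr rfl fun v _ => ?_
      split_ifs <;> ring
    have h2 : (G.adjMatrix ℝ).mulVec x =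
        ∑ i, (c i * hA.eigenvalues i) • (hA.eigenvectorBasis i).ofLp := by
      conv_lhs => rw [hx]
      rw [Matrix.mulVec_sum]
      refine Finset.sum_congr rfl fun i _ => ?_
      rw [Matrix.mulVec_smul, hA.mulVec_eigenvectorBasis, smul_smul]
    rw [h1, h2, dotProduct_sum]
    refine Finset.sum_congr rfl fun i _ => ?_
    rw [dotProduct_smul, hci, smul_eq_mul]
    change _ = hA.eigenvalues i * c i ^ 2
    ring
  · rw [mahler, mapMahlerMeasure_eq, map_jouk_eq_prod (μ := hA.eigenvalues), mahlerMeasure_prod]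
    · exact Finset.prod_congr rfl fun i _ => mahlerMeasure_quad _
    · have h1 : charPoly G = (G.adjMatrix ℤ).charpoly := by unfold charPoly; congr!
      have h2 : G.adjMatrix ℂ = (G.adjMatrix ℝ).map (Complex.ofRealHom) := by
        ext i j; simp [SimpleGraph.adjMatrix_apply, apply_ite]
      have h3 : G.adjMatrix ℂ = (G.adjMatrix ℤ).map (Int.castRingHom ℂ) := by
        ext i j; simp [SimpleGraph.adjMatrix_apply, apply_ite]
      rw [h1, ← Matrix.charpoly_map, ← h3, h2, Matrix.charpoly_map, hA.charpoly_eq,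
        Polynomial.map_prod]
      simp

/-- A weighted mean cannot exceed all its entries; with `d = c x ^ 2` this turns a Rayleigh quotient
into an eigenvalue. -/
theorem exists_le_of_sum_le {ι : Type*} [Fintype ι] {μ d : ι → ℝ} {l : ℝ} (hd : ∀ i, 0 ≤ d i)
    (hpos : 0 < ∑ i, d i) (h : l * ∑ i, d i ≤ ∑ i, μ i * d i) : ∃ i, l ≤ μ i := by
  by_contra! hlt
  obtain ⟨i, -, hi⟩ := Finset.exists_ne_zero_of_sum_ne_zero hpos.ne'
  refine h.not_gt ?_
  rw [Finset.mul_sum]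
  exact Finset.sum_lt_sum (fun j _ => mul_le_mul_of_nonneg_right (hlt j).le (hd j))
    ⟨i, Finset.mem_univ i, mul_lt_mul_of_pos_right (hlt i) ((hd i).lt_of_ne' hi)⟩

theorem sum_sq_pos {V : Type*} [Fintype V] {x : V → ℝ} (hx : x ≠ 0) : 0 < ∑ i, x i ^ 2 := by
  obtain ⟨i, hi⟩ := Function.ne_iff.mp hx
  exact Finset.sum_pos' (fun _ _ => sq_nonneg _) ⟨i, Finset.mem_univ i, by
    have : x i ≠ 0 := hi
    positivity⟩

theorem prod_le_prod_univ {ι : Type*} [Fintype ι] {f : ι → ℝ} (hf : ∀ i, 1 ≤ f i)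
    (s : Finset ι) : ∏ i ∈ s, f i ≤ ∏ i, f i := by
  rw [← Finset.prod_mul_prod_compl s f]
  exact le_mul_of_one_le_right (Finset.prod_nonneg fun i _ => zero_le_one.trans (hf i))
    (Finset.prod_induction f (1 ≤ ·) (fun _ _ => one_le_mul_of_one_le_of_one_le) le_rfl
      fun i _ => hf i)

theorem combination_sq_pos {p q a b : ℝ} (hp : 0 < p) (hq : 0 < q)
    (hab : 0 < a ^ 2 + b ^ 2) : 0 < p * a ^ 2 + q * b ^ 2 := by
  have h1 : 0 ≤ p * a ^ 2 := by positivity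
  have h2 : 0 ≤ q * b ^ 2 := by positivity
  by_contra h
  have h3 : p * a ^ 2 = 0 := by linarith
  have h4 : q * b ^ 2 = 0 := by linarith
  have h5 := (mul_eq_zero.mp h3).resolve_left hp.ne'
  have h6 := (mul_eq_zero.mp h4).resolve_left hq.ne'
  linarith

/-- The largest eigenvalue of `G` is at least `l`. -/
def EigGe {V : Type*} [Fintype V] (G : SimpleGraph V) (l : ℝ) : Prop :=
  ∃ x : V → ℝ, x ≠ 0 ∧ l * ∑ i, x i ^ 2 ≤ adjForm G x

/-- The smallest eigenvalue of `G` is at most `-l`. -/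
def EigLeNeg {V : Type*} [Fintype V] (G : SimpleGraph V) (l : ℝ) : Prop :=
  ∃ x : V → ℝ, x ≠ 0 ∧ adjForm G x ≤ -l * ∑ i, x i ^ 2

theorem EigGe.quadMahler_le {V : Type*} [Fintype V] {G : SimpleGraph V} {l : ℝ} (hl : 0 < l)
    (h : EigGe G l) : quadMahler l ≤ mahler G := by
  obtain ⟨μ, c, hc, hμ, hM⟩ := exists_spectral G
  obtain ⟨x, hx, hle⟩ := h
  rw [hμ, ← hc] at hle
  obtain ⟨i, hi⟩ := exists_le_of_sum_le (fun i => sq_nonneg (c x i))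
    (by rw [hc]; exact sum_sq_pos hx) hle
  rw [hM]
  refine (quadMahler_mono (abs_le_abs_of_nonneg hl.le hi)).trans ?_
  simpa using prod_le_prod_univ (fun i => one_le_quadMahler (μ i)) {i}

theorem quadMahler_sq_le {V : Type*} [Fintype V] {G : SimpleGraph V} {l : ℝ} (hl : 0 < l)
    (h : EigGe G l) (h' : EigLeNeg G l) : quadMahler l ^ 2 ≤ mahler G := by
  obtain ⟨μ, c, hc, hμ, hM⟩ := exists_spectral G
  obtain ⟨x, hx, hle⟩ := h
  obtain ⟨y, hy, hle'⟩ := h'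
  rw [hμ, ← hc] at hle hle'
  obtain ⟨i, hi⟩ := exists_le_of_sum_le (fun i => sq_nonneg (c x i))
    (by rw [hc]; exact sum_sq_pos hx) hle
  obtain ⟨j, hj⟩ := exists_le_of_sum_le (μ := fun j => - μ j) (l := l)
    (fun i => sq_nonneg (c y i)) (by rw [hc]; exact sum_sq_pos hy)
    (by simp only [neg_mul, Finset.sum_neg_distrib] at hle' ⊢; linarith)
  have hij : i ≠ j := by rintro rfl; linarith
  have h1 := quadMahler_mono (abs_le_abs_of_nonneg hl.le hi)
  have h2 := quadMahler_mono (abs_le_abs_of_nonneg hl.le hj)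
  rw [quadMahler_neg] at h2
  have h0 := one_le_quadMahler l
  rw [hM]
  calc quadMahler l ^ 2 = quadMahler l * quadMahler l := sq _
    _ ≤ quadMahler (μ i) * quadMahler (μ j) := mul_le_mul h1 h2 (by linarith) (by linarith)
    _ = ∏ k ∈ {i, j}, quadMahler (μ k) :=
      (Finset.prod_pair (f := fun k => quadMahler (μ k)) hij).symm
    _ ≤ _ := prod_le_prod_univ (fun i => one_le_quadMahler (μ i)) _

/-- A bound for the quadratic form on vectors supported where a positive function is
superharmonic. -/
theorem abs_adjForm_le {V : Type*} [Fintype V] {G : SimpleGraph V} {l : ℝ} {w x : V → ℝ}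
    (hw : ∀ v, 0 < w v)
    (h : ∀ u, x u ≠ 0 → (∑ v, if G.Adj u v then w v else 0) ≤ l * w u) :
    |adjForm G x| ≤ l * ∑ i, x i ^ 2 := by
  -- Weighted AM-GM on each edge. The ratios of `w` are chosen so that the coefficient of `x u ^ 2`
  -- sums over `v` to `(A w) u / w u`.
  have h1 : ∀ u v, |if G.Adj u v then x u * x v else 0| ≤
      (if G.Adj u v then w v / w u * x u ^ 2 else 0) / 2 +
        (if G.Adj u v then w u / w v * x v ^ 2 else 0) / 2 := by
    intro u v
    split_ifs
    · have hu := hw u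
      have hv := hw v
      have key : 0 ≤ (w v * |x u| - w u * |x v|) ^ 2 / (w u * w v) := by positivity
      have e : (w v * |x u| - w u * |x v|) ^ 2 / (w u * w v) =
          w v / w u * |x u| ^ 2 + w u / w v * |x v| ^ 2 - 2 * (|x u| * |x v|) := by
        field_simp
        ring
      rw [abs_mul, ← sq_abs (x u), ← sq_abs (x v)]
      linarith
    · simp
  have h2 : ∑ u, ∑ v, (if G.Adj u v then w u / w v * x v ^ 2 else 0) =
      ∑ u, ∑ v, (if G.Adj u v then w v / w u * x u ^ 2 else 0) := by
    rw [Finset.sum_comm]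
    simp only [G.adj_comm]
  have h3 : ∀ u, ∑ v, (if G.Adj u v then w v / w u * x u ^ 2 else 0) ≤ l * x u ^ 2 := by
    intro u
    by_cases hu : x u = 0
    · simp [hu]
    · have e : ∑ v, (if G.Adj u v then w v / w u * x u ^ 2 else 0) =
          (∑ v, if G.Adj u v then w v else 0) * (x u ^ 2 / w u) := by
        rw [Finset.sum_mul]
        refine Finset.sum_congr rfl fun v _ => ?_
        split_ifs
        · ring
        · simp
      rw [e]
      have hp := hw u
      calc _ ≤ l * w u * (x u ^ 2 / w u) := by gcongr; exact h u hu
        _ = l * x u ^ 2 := by field_simp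
  calc |adjForm G x| ≤ ∑ u, ∑ v, |if G.Adj u v then x u * x v else 0| := by
        refine (Finset.abs_sum_le_sum_abs _ _).trans ?_
        exact Finset.sum_le_sum fun u _ => Finset.abs_sum_le_sum_abs _ _
    _ ≤ ∑ u, ∑ v, ((if G.Adj u v then w v / w u * x u ^ 2 else 0) / 2 +
        (if G.Adj u v then w u / w v * x v ^ 2 else 0) / 2) :=
        Finset.sum_le_sum fun u _ => Finset.sum_le_sum fun v _ => h1 u v
    _ = ∑ u, ∑ v, (if G.Adj u v then w v / w u * x u ^ 2 else 0) := by
        simp only [Finset.sum_add_distrib, ← Finset.sum_div]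
        rw [h2]; ring
    _ ≤ ∑ u, l * x u ^ 2 := Finset.sum_le_sum fun u _ => h3 u
    _ = _ := (Finset.mul_sum _ _ _).symm

/-- There is a positive function `w` with `A w ≤ l w`, where `A` is the adjacency matrix. -/
def Superharmonic {V : Type*} [Fintype V] (G : SimpleGraph V) (l : ℝ) : Prop :=
  ∃ w : V → ℝ, (∀ v, 0 < w v) ∧ ∀ u, (∑ v, if G.Adj u v then w v else 0) ≤ l * w u

theorem abs_le_of_superharmonic {V : Type*} [Fintype V] {G : SimpleGraph V} {l : ℝ}
    {μ : V → ℝ} {c : (V → ℝ) ≃ₗ[ℝ] (V → ℝ)} (hc : ∀ x, ∑ i, c x i ^ 2 = ∑ i, x i ^ 2)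
    (hμ : ∀ x, adjForm G x = ∑ i, μ i * c x i ^ 2)
    (h : Superharmonic G l) (i : V) : |μ i| ≤ l := by
  obtain ⟨w, hw, hle⟩ := h
  have := abs_adjForm_le (x := c.symm (Pi.single i 1)) hw fun u _ => hle u
  rw [hμ, ← hc] at this
  simpa [Pi.single_apply] using this

theorem Superharmonic.mahler_eq_one {V : Type*} [Fintype V] {G : SimpleGraph V}
    (h : Superharmonic G 2) : mahler G = 1 := by
  obtain ⟨μ, c, hc, hμ, hM⟩ := exists_spectral G
  rw [hM]
  exact Finset.prod_eq_one fun i _ =>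
    quadMahler_of_abs_le (abs_le_of_superharmonic hc hμ h i)

/-- If all but one vertex have at most two neighbours, then at most one eigenvalue exceeds `2` and
at most one is less than `-2`. -/
theorem Superharmonic.mahler_le {V : Type*} [Fintype V] {G : SimpleGraph V} {l : ℝ}
    (h : Superharmonic G l) {o : V}
    (ho : ∀ u, u ≠ o → (∑ v, if G.Adj u v then (1 : ℝ) else 0) ≤ 2) :
    mahler G ≤ quadMahler l ^ 2 := by
  obtain ⟨μ, c, hc, hμ, hM⟩ := exists_spectral G
  have hbd := abs_le_of_superharmonic hc hμ h
  have key : ∀ i j, i ≠ j → ∃ a b : ℝ, 0 < a ^ 2 + b ^ 2 ∧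
      |μ i * a ^ 2 + μ j * b ^ 2| ≤ 2 * (a ^ 2 + b ^ 2) := by
    intro i j hij
    set p := c.symm (Pi.single i 1) with hp
    set q := c.symm (Pi.single j 1) with hq
    -- The plane spanned by two eigenvectors contains a nonzero vector vanishing at `o`. On its
    -- support the rows of `A` sum to at most `2`, so the constant weight `1` bounds the form.
    obtain ⟨a, b, hab, h0⟩ : ∃ a b : ℝ, 0 < a ^ 2 + b ^ 2 ∧ a * p o + b * q o = 0 := by
      by_cases hpo : p o = 0
      · exact ⟨1, 0, by norm_num, by simp [hpo]⟩
      · exact ⟨q o, -p o, by nlinarith [sq_nonneg (q o), pow_pos (abs_pos.mpr hpo) 2, sq_abs (p o)], by ring⟩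
    refine ⟨a, b, hab, ?_⟩
    have h1 := abs_adjForm_le (G := G) (l := 2) (w := fun _ => 1) (x := a • p + b • q) (by simp)
      (fun u hu => by
        rw [mul_one]
        exact ho u fun e => hu (by simpa [e] using h0))
    have h2 : c (a • p + b • q) = a • Pi.single i 1 + b • Pi.single j 1 := by
      simp [hp, hq]
    have h3 : ∀ f : V → ℝ, ∑ k, f k * c (a • p + b • q) k ^ 2 = f i * a ^ 2 + f j * b ^ 2 := by
      intro f
      rw [h2, ← Finset.sum_subset (Finset.subset_univ {i, j}), Finset.sum_pair hij]
      · simp [hij, hij.symm]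
      · intro k _ hk
        simp only [Finset.mem_insert, Finset.mem_singleton, not_or] at hk
        simp [hk.1, hk.2]
    have h4 := h3 1
    simp only [Pi.one_apply, one_mul] at h4
    rwa [hμ, h3, ← hc, h4] at h1
  have hpos : ∀ i j, 2 < μ i → 2 < μ j → i = j := by
    intro i j hi hj
    by_contra hij
    obtain ⟨a, b, hab, hle⟩ := key i j hij
    have := (le_abs_self _).trans hle
    linarith [combination_sq_pos (sub_pos.mpr hi) (sub_pos.mpr hj) hab]
  have hneg : ∀ i j, μ i < -2 → μ j < -2 → i = j := by
    intro i j hi hj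
    by_contra hij
    obtain ⟨a, b, hab, hle⟩ := key i j hij
    have := (neg_le_abs _).trans hle
    linarith [combination_sq_pos (sub_pos.mpr hi) (sub_pos.mpr hj) hab]
  have hone : ∀ s : Finset V, (∀ i ∈ s, ∀ j ∈ s, i = j) →
      ∏ i ∈ s, quadMahler (μ i) ≤ quadMahler l := by
    intro s hs
    rcases s.eq_empty_or_nonempty with rfl | ⟨i, hi⟩
    · simpa using one_le_quadMahler l
    · have : s = {i} := Finset.eq_singleton_iff_unique_mem.mpr ⟨hi, fun j hj => hs j hj i hi⟩
      rw [this, Finset.prod_singleton]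
      exact quadMahler_mono ((hbd i).trans (le_abs_self l))
  have hsplit : ∏ i, quadMahler (μ i) =
      (∏ i with 2 < μ i, quadMahler (μ i)) * ∏ i with μ i < -2, quadMahler (μ i) := by
    rw [← Finset.prod_union]
    · refine (Finset.prod_subset (Finset.subset_univ _) fun i _ hi => ?_).symm
      simp only [Finset.mem_union, Finset.mem_filter, Finset.mem_univ, true_and, not_or,
        not_lt] at hi
      exact quadMahler_of_abs_le (abs_le.mpr ⟨hi.2, hi.1⟩)
    · rw [Finset.disjoint_filter]
      intro i _ h1 h2
      linarith
  rw [hM, hsplit, sq]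
  have := one_le_quadMahler l
  refine mul_le_mul (hone _ ?_) (hone _ ?_)
    (Finset.prod_nonneg fun i _ => zero_le_one.trans (one_le_quadMahler _)) (by linarith)
  · simp only [Finset.mem_filter, Finset.mem_univ, true_and]
    exact fun i hi j hj => hpos i j hi hj
  · simp only [Finset.mem_filter, Finset.mem_univ, true_and]
    exact fun i hi j hj => hneg i j hi hj

end GraphMahler

/-! ### Subharmonic functions assembled from branches. -/

namespace GraphMahler

open Polynomial
open scoped Classical

section AdjSum

variable {V : Type*} [Fintype V] {G : SimpleGraph V}

/-- The sum of `x` over the neighbours of `u`. -/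
noncomputable def adjSum (G : SimpleGraph V) (x : V → ℝ) (u : V) : ℝ :=
  ∑ v, if G.Adj u v then x v else 0

theorem adjSum_add (x y : V → ℝ) (u : V) :
    adjSum G (x + y) u = adjSum G x u + adjSum G y u := by
  rw [adjSum, adjSum, adjSum, ← Finset.sum_add_distrib]
  refine Finset.sum_congr rfl fun v _ => ?_
  split_ifs <;> simp

theorem adjSum_smul (a : ℝ) (x : V → ℝ) (u : V) : adjSum G (a • x) u = a * adjSum G x u := by
  simp [adjSum, Finset.mul_sum]

theorem adjSum_sum {ι : Type*} (s : Finset ι) (x : ι → V → ℝ) (u : V) :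
    adjSum G (∑ i ∈ s, x i) u = ∑ i ∈ s, adjSum G (x i) u := by
  simp only [adjSum, Finset.sum_apply]
  rw [Finset.sum_comm]
  refine Finset.sum_congr rfl fun v _ => ?_
  split_ifs <;> simp

theorem adjSum_single (v u : V) :
    adjSum G (Pi.single v 1) u = if G.Adj u v then 1 else 0 := by
  rw [adjSum, Finset.sum_eq_single v] <;> simp +contextual

theorem adjForm_eq_sum_mul_adjSum (x : V → ℝ) : adjForm G x = ∑ u, x u * adjSum G x u := by
  simp [adjForm, adjSum, Finset.mul_sum]

/-- There is a nonzero `x ≥ 0` with `A x ≥ l x`, where `A` is the adjacency matrix. -/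
def Subharmonic (G : SimpleGraph V) (l : ℝ) : Prop :=
  ∃ x : V → ℝ, x ≠ 0 ∧ (∀ u, 0 ≤ x u) ∧ ∀ u, l * x u ≤ adjSum G x u

theorem Subharmonic.eigGe {l : ℝ} (h : Subharmonic G l) : EigGe G l := by
  obtain ⟨x, hx, h0, hle⟩ := h
  refine ⟨x, hx, ?_⟩
  rw [adjForm_eq_sum_mul_adjSum, Finset.mul_sum]
  refine Finset.sum_le_sum fun u _ => ?_
  nlinarith [hle u, h0 u]

/-- Changing the sign of `x` on one colour class negates the form and keeps the norm. -/
theorem EigGe.eigLeNeg {l : ℝ} (hG : G.IsBipartite) (h : EigGe G l) : EigLeNeg G l := by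
  obtain ⟨x, hx, hle⟩ := h
  obtain ⟨C⟩ := hG
  set ε : V → ℝ := fun v => if C v = 0 then 1 else -1 with hε
  have hsq : ∀ v, ε v ^ 2 = 1 := fun v => by simp only [hε]; split_ifs <;> norm_num
  have hadj : ∀ u v, G.Adj u v → ε u * ε v = -1 := by
    intro u v huv
    have hne := C.valid huv
    simp only [hε]
    split_ifs with h1 h2 h2
    · exact absurd (h1.trans h2.symm) hne
    · norm_num
    · norm_num
    · exact absurd (by omega) hne
  refine ⟨fun v => ε v * x v, ?_, ?_⟩
  · obtain ⟨v, hv⟩ := Function.ne_iff.mp hx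
    refine Function.ne_iff.mpr ⟨v, mul_ne_zero (fun h => ?_) hv⟩
    have := hsq v
    rw [h] at this
    norm_num at this
  · have h1 : adjForm G (fun v => ε v * x v) = - adjForm G x := by
      simp only [adjForm, ← Finset.sum_neg_distrib]
      refine Finset.sum_congr rfl fun u _ => Finset.sum_congr rfl fun v _ => ?_
      split_ifs with huv
      · linear_combination (x u * x v) * hadj u v huv
      · simp
    have h2 : ∑ i, (ε i * x i) ^ 2 = ∑ i, x i ^ 2 :=
      Finset.sum_congr rfl fun v _ => by rw [mul_pow, hsq, one_mul]
    rw [h1, h2]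
    linarith

/-- A weighted family of rooted trees immersed in `G`, starting with the edge from `v` to `w`, on
which `A x ≥ l x` when `v` has weight `1`, and whose contribution at `v` is at least `r`. -/
def Branch (G : SimpleGraph V) (l : ℝ) (v w : V) (r : ℝ) : Prop :=
  ∃ x : V → ℝ, (∀ u, 0 ≤ x u) ∧
    ∀ u, l * x u + (if u = v then r else 0) ≤ adjSum G x u + if u = w then 1 else 0

theorem Branch.mono {l : ℝ} {v w : V} {r r' : ℝ} (h : Branch G l v w r) (hr : r' ≤ r) :
    Branch G l v w r' := by
  obtain ⟨x, h0, hx⟩ := h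
  refine ⟨x, h0, fun u => (add_le_add_right ?_ _).trans (hx u)⟩
  split_ifs <;> simp [hr]

omit [Fintype V] in
theorem sum_ite_eq_le {ι : Type*} [Fintype ι] {u : ι → V} (hu : Function.Injective u) (z : V) :
    ∑ i, (if z = u i then (1 : ℝ) else 0) ≤ 1 := by
  rw [← Finset.sum_image (f := fun y => if z = y then (1 : ℝ) else 0) (fun i _ j _ h => hu h)]
  rw [Finset.sum_ite_eq]
  split_ifs <;> norm_num

theorem sum_branch_le {ι : Type*} [Fintype ι] {l : ℝ} {w : V} {u : ι → V} {r : ι → ℝ}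
    {X : ι → V → ℝ}
    (hX : ∀ i z, l * X i z + (if z = w then r i else 0) ≤
      adjSum G (X i) z + if z = u i then 1 else 0) (z : V) :
    l * ∑ i, X i z + (if z = w then ∑ i, r i else 0) ≤
      ∑ i, adjSum G (X i) z + ∑ i, if z = u i then 1 else 0 := by
  have := Finset.sum_le_sum fun i (_ : i ∈ Finset.univ) => hX i z
  rw [Finset.sum_add_distrib, Finset.sum_add_distrib, ← Finset.mul_sum] at this
  refine le_trans (le_of_eq ?_) this
  split_ifs <;> simp

/-- Give `w` weight `s` and scale the branches beyond it by `s`; balance at `w`, where `v`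
contributes `1`, reads `s (l - ∑ r i) = 1`. The inequality is linear, so branches may overlap in
`G`: the construction takes place in the universal cover and weights are summed over fibres. -/
theorem Branch.extend {ι : Type*} [Fintype ι] {l : ℝ} {v w : V} {u : ι → V} {r : ι → ℝ}
    (hvw : G.Adj v w) (hu : Function.Injective u) (hadj : ∀ i, G.Adj w (u i))
    (hne : ∀ i, u i ≠ v) (hlt : ∑ i, r i < l) (h : ∀ i, Branch G l w (u i) (r i)) :
    Branch G l v w (1 / (l - ∑ i, r i)) := by
  choose X hX0 hX using h
  have hl : 0 < l - ∑ i, r i := by linarith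
  set s := 1 / (l - ∑ i, r i) with hs
  have hs0 : 0 ≤ s := by positivity
  have hsl : s * (l - ∑ i, r i) = 1 := by rw [hs]; field_simp
  refine ⟨s • (Pi.single w 1 + ∑ i, X i), fun z => ?_, fun z => ?_⟩
  · have h1 : 0 ≤ (Pi.single w 1 : V → ℝ) z := by
      rw [Pi.single_apply]; split_ifs <;> norm_num
    have h2 : 0 ≤ ∑ i, X i z := Finset.sum_nonneg fun i _ => hX0 i z
    simp only [Pi.smul_apply, Pi.add_apply, Finset.sum_apply, smul_eq_mul]
    positivity
  · rw [adjSum_smul, adjSum_add, adjSum_sum, adjSum_single]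
    have h1 := sum_branch_le hX z
    -- The only geometric input: `v` and the `u i` are distinct neighbours of `w`.
    have h2 : (if z = v then (1 : ℝ) else 0) + ∑ i, (if z = u i then (1 : ℝ) else 0) ≤
        if G.Adj z w then 1 else 0 := by
      by_cases hzv : z = v
      · subst hzv
        rw [if_pos rfl, if_pos hvw, Finset.sum_eq_zero fun i _ => if_neg (hne i).symm, add_zero]
      · rw [if_neg hzv, zero_add]
        by_cases hz : ∃ i, z = u i
        · obtain ⟨i, rfl⟩ := hz
          rw [if_pos (hadj i).symm]
          exact sum_ite_eq_le hu _
        · push Not at hz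
          rw [Finset.sum_eq_zero fun i _ => if_neg (hz i)]
          split_ifs <;> norm_num
    have e1 : (if z = w then ∑ i, r i else 0) = (if z = w then 1 else 0) * ∑ i, r i := by
      split_ifs <;> simp
    have e2 : (if z = v then s else 0) = s * if z = v then 1 else 0 := by
      split_ifs <;> simp
    rw [e1] at h1
    rw [e2]
    simp only [Pi.smul_apply, Pi.add_apply, Finset.sum_apply, smul_eq_mul, Pi.single_apply]
    linear_combination s * h1 + s * h2 + (if z = w then (1 : ℝ) else 0) * hsl

theorem Subharmonic.of_branch {ι : Type*} [Fintype ι] {l : ℝ} {v : V} {u : ι → V} {r : ι → ℝ}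
    (hu : Function.Injective u) (hadj : ∀ i, G.Adj v (u i)) (hle : l ≤ ∑ i, r i)
    (h : ∀ i, Branch G l v (u i) (r i)) : Subharmonic G l := by
  choose X hX0 hX using h
  have hnn : ∀ z, 0 ≤ ∑ i, X i z := fun z => Finset.sum_nonneg fun i _ => hX0 i z
  refine ⟨Pi.single v 1 + ∑ i, X i, ?_, fun z => ?_, fun z => ?_⟩
  · refine Function.ne_iff.mpr ⟨v, ne_of_gt ?_⟩
    simp only [Pi.add_apply, Finset.sum_apply, Pi.single_eq_same, Pi.zero_apply]
    linarith [hnn v]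
  · simp only [Pi.add_apply, Finset.sum_apply, Pi.single_apply]
    split_ifs <;> linarith [hnn z]
  · rw [adjSum_add, adjSum_sum, adjSum_single]
    have h1 := sum_branch_le hX z
    have h2 : ∑ i, (if z = u i then (1 : ℝ) else 0) ≤ if G.Adj z v then 1 else 0 := by
      by_cases hz : ∃ i, z = u i
      · obtain ⟨i, rfl⟩ := hz
        rw [if_pos (hadj i).symm]
        exact sum_ite_eq_le hu _
      · push Not at hz
        rw [Finset.sum_eq_zero fun i _ => if_neg (hz i)]
        split_ifs <;> norm_num
    simp only [Pi.add_apply, Finset.sum_apply, Pi.single_apply]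
    by_cases hzv : z = v <;> simp only [hzv, if_true, if_false] at h1 h2 ⊢ <;> nlinarith

theorem Branch.leaf {l : ℝ} (hl : 0 < l) {v w : V} (h : G.Adj v w) : Branch G l v w (1 / l) := by
  simpa using Branch.extend (ι := Fin 0) (u := Fin.elim0) (r := Fin.elim0) h
    (fun i => i.elim0) (fun i => i.elim0) (fun i => i.elim0) (by simpa using hl) (fun i => i.elim0)

theorem Branch.step {l r : ℝ} {v w u : V} (hvw : G.Adj v w) (hwu : G.Adj w u) (hne : u ≠ v)
    (hr : r < l) (h : Branch G l w u r) : Branch G l v w (1 / (l - r)) := by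
  simpa using Branch.extend (ι := Fin 1) (u := fun _ => u) (r := fun _ => r) hvw
    (Function.injective_of_subsingleton _) (fun _ => hwu) (fun _ => hne) (by simpa using hr)
    (fun _ => h)

theorem injective_pair {α : Type*} {a b : α} (h : a ≠ b) : Function.Injective ![a, b] := by
  intro i j hij
  fin_cases i <;> fin_cases j <;> simp_all

theorem injective_triple {α : Type*} {a b c : α} (h1 : a ≠ b) (h2 : a ≠ c) (h3 : b ≠ c) :
    Function.Injective ![a, b, c] := by
  intro i j hij
  fin_cases i <;> fin_cases j <;> simp_all

theorem Branch.fork {l : ℝ} (hl : 2 ≤ l) {v w a b : V} (hvw : G.Adj v w) (ha : G.Adj w a)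
    (hb : G.Adj w b) (hab : a ≠ b) (hav : a ≠ v) (hbv : b ≠ v) :
    Branch G l v w (1 / (l - 2 / l)) := by
  have h0 : 0 < l := by linarith
  have := Branch.extend (l := l) (v := v) (w := w) (u := ![a, b]) (r := fun _ => 1 / l) hvw
    (injective_pair hab) (by simp [Fin.forall_fin_two, ha, hb])
    (by simp [Fin.forall_fin_two, hav, hbv])
    (by
      simp only [Fin.sum_univ_two, ← two_mul, mul_one_div]
      rw [div_lt_iff₀ h0]; nlinarith)
    (by simp [Fin.forall_fin_two, -one_div, Branch.leaf h0 ha, Branch.leaf h0 hb])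
  simpa only [Fin.sum_univ_two, ← two_mul, mul_one_div] using this

theorem Subharmonic.of_three_branches {l : ℝ} {v a b c : V} {ra rb rc : ℝ} (ha : G.Adj v a)
    (hb : G.Adj v b) (hc : G.Adj v c) (hab : a ≠ b) (hac : a ≠ c) (hbc : b ≠ c)
    (hA : Branch G l v a ra) (hB : Branch G l v b rb) (hC : Branch G l v c rc)
    (hle : l ≤ ra + rb + rc) : Subharmonic G l :=
  Subharmonic.of_branch (v := v) (u := ![a, b, c]) (r := ![ra, rb, rc]) (injective_triple hab hac hbc)
    (by simp [Fin.forall_fin_succ, ha, hb, hc]) (by simpa [Fin.sum_univ_three] using hle)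
    (by simp [Fin.forall_fin_succ, hA, hB, hC])

/-- The contribution of a path with `k` vertices to the vertex at which it is attached. -/
noncomputable def armRatio (l : ℝ) : ℕ → ℝ
  | 0 => 0
  | k + 1 => 1 / (l - armRatio l k)

theorem armRatio_nonneg_lt_one {l : ℝ} (hl : 2 ≤ l) (k : ℕ) :
    0 ≤ armRatio l k ∧ armRatio l k < 1 := by
  induction k with
  | zero => simp [armRatio]
  | succ k ih =>
    have : 1 < l - armRatio l k := by linarith [ih.2]
    rw [armRatio]
    exact ⟨by positivity, by rw [div_lt_one (by linarith)]; exact this⟩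

theorem armRatio_mono {l : ℝ} (hl : 2 ≤ l) : Monotone (armRatio l) := by
  refine monotone_nat_of_le_succ fun k => ?_
  induction k with
  | zero => exact (armRatio_nonneg_lt_one hl 1).1
  | succ k ih =>
    rw [armRatio, armRatio]
    have := (armRatio_nonneg_lt_one hl (k + 1)).2
    exact one_div_le_one_div_of_le (by linarith) (by linarith)

/-- The first `n` steps of `q` are edges of `G`, and no edge is traversed back immediately. -/
structure NonBacktracking (G : SimpleGraph V) (q : ℕ → V) (n : ℕ) : Prop where
  adj : ∀ k < n, G.Adj (q k) (q (k + 1))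
  ne : ∀ k, k + 2 ≤ n → q (k + 2) ≠ q k

theorem NonBacktracking.branch {l : ℝ} (hl : 2 ≤ l) {n : ℕ} {q : ℕ → V}
    (h : NonBacktracking G q (n + 1)) : Branch G l (q 0) (q 1) (armRatio l (n + 1)) := by
  induction n generalizing q with
  | zero => simpa [armRatio] using Branch.leaf (by linarith) (h.adj 0 (by omega))
  | succ n ih =>
    have h' : NonBacktracking G (fun k => q (k + 1)) (n + 1) :=
      ⟨fun k hk => h.adj (k + 1) (by omega), fun k hk => h.ne (k + 1) (by omega)⟩
    exact Branch.step (h.adj 0 (by omega)) (h.adj 1 (by omega)) (h.ne 0 (by omega))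
      (by linarith [(armRatio_nonneg_lt_one hl (n + 1)).2]) (ih h')

/-- Inside `S` a walk can always go on without backtracking, since one of two neighbours in `S`
differs from the previous vertex. So arms of any length can be immersed. -/
theorem branch_of_mem_core {l : ℝ} (hl : 2 ≤ l) {S : Set V}
    (hS : ∀ v ∈ S, ∃ a ∈ S, ∃ b ∈ S, a ≠ b ∧ G.Adj v a ∧ G.Adj v b) (n : ℕ) {v w : V}
    (hvw : G.Adj v w) (hw : w ∈ S) : Branch G l v w (armRatio l (n + 1)) := by
  induction n generalizing v w with
  | zero => simpa [armRatio] using Branch.leaf (by linarith) hvw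
  | succ n ih =>
    have hlt : armRatio l (n + 1) < l := by linarith [(armRatio_nonneg_lt_one hl (n + 1)).2]
    obtain ⟨a, ha, b, hb, hab, hwa, hwb⟩ := hS w hw
    by_cases hav : a = v
    · exact Branch.step hvw hwb (fun h => hab (hav.trans h.symm)) hlt (ih hwb hb)
    · exact Branch.step hvw hwa hav hlt (ih hwa ha)

omit [Fintype V] in
theorem exists_core_of_not_isAcyclic (h : ¬ G.IsAcyclic) :
    ∃ S : Set V, S.Nonempty ∧
      ∀ v ∈ S, ∃ a ∈ S, ∃ b ∈ S, a ≠ b ∧ G.Adj v a ∧ G.Adj v b := by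
  unfold SimpleGraph.IsAcyclic at h
  push Not at h
  obtain ⟨v, c, hc⟩ := h
  refine ⟨c.toSubgraph.verts, ⟨v, by simp⟩, fun u hu => ?_⟩
  have h2 := hc.ncard_neighborSet_toSubgraph_eq_two (by simpa using hu)
  obtain ⟨a, b, hab, he⟩ := Set.ncard_eq_two.mp h2
  have ha : c.toSubgraph.Adj u a := by
    rw [← SimpleGraph.Subgraph.mem_neighborSet, he]; simp
  have hb : c.toSubgraph.Adj u b := by
    rw [← SimpleGraph.Subgraph.mem_neighborSet, he]; simp
  exact ⟨a, ha.snd_mem, b, hb.snd_mem, hab, ha.adj_sub, hb.adj_sub⟩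

omit [Fintype V] in
theorem eq_univ_of_adj_closed (hG : G.Connected) {S : Set V} (hS : S.Nonempty)
    (h : ∀ u ∈ S, ∀ v, G.Adj u v → v ∈ S) (v : V) : v ∈ S := by
  obtain ⟨u, hu⟩ := hS
  have := (SimpleGraph.reachable_iff_reflTransGen u v).mp (hG.preconnected u v)
  induction this with
  | refl => exact hu
  | tail _ hbc ih => exact h _ ih _ hbc

/-- Some vertex has two neighbours on a cycle and a third one: `v₀` if the cycle meets every vertex,
else a vertex where an edge leaves the cycle. Winding round the cycle gives two long arms. -/
theorem subharmonic_of_not_isAcyclic (hG : G.Connected) (hc : ¬ G.IsAcyclic) {v₀ : V}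
    (hv₀ : 2 < G.degree v₀) : Subharmonic G (61 / 30) := by
  obtain ⟨S, hSne, hS⟩ := exists_core_of_not_isAcyclic hc
  have key : ∃ v a b c, G.Adj v a ∧ G.Adj v b ∧ G.Adj v c ∧ a ≠ b ∧ a ≠ c ∧ b ≠ c ∧
      a ∈ S ∧ b ∈ S := by
    by_cases hcl : ∀ u ∈ S, ∀ v, G.Adj u v → v ∈ S
    · have hall := eq_univ_of_adj_closed hG hSne hcl
      rw [← SimpleGraph.card_neighborFinset_eq_degree, Finset.two_lt_card] at hv₀
      obtain ⟨a, ha, b, hb, c, hc, hab, hac, hbc⟩ := hv₀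
      simp only [SimpleGraph.mem_neighborFinset] at ha hb hc
      exact ⟨v₀, a, b, c, ha, hb, hc, hab, hac, hbc, hall a, hall b⟩
    · push Not at hcl
      obtain ⟨u, hu, c, huc, hcS⟩ := hcl
      obtain ⟨a, ha, b, hb, hab, hua, hub⟩ := hS u hu
      exact ⟨u, a, b, c, hua, hub, huc, hab, fun h => hcS (h ▸ ha), fun h => hcS (h ▸ hb), ha, hb⟩
  -- Two arms of five vertices and a leaf suffice; arms of four would fall just short of `61/30`.
  obtain ⟨v, a, b, c, ha, hb, hc, hab, hac, hbc, haS, hbS⟩ := key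
  refine Subharmonic.of_three_branches ha hb hc hab hac hbc
    (branch_of_mem_core (by norm_num) hS 4 ha haS) (branch_of_mem_core (by norm_num) hS 4 hb hbS)
    (Branch.leaf (by norm_num) hc) ?_
  norm_num [armRatio]

end AdjSum

end GraphMahler

/-! ### Sub- and superharmonic functions on starlike trees. -/

namespace GraphMahler

open Polynomial
open scoped Classical

section Starlike

theorem T_adj_none_some {a b c : ℕ} (i : Fin 3) (k : Fin (![a, b, c] i)) :
    (T a b c).Adj none (some ⟨i, k⟩) ↔ k.val = 0 := by
  simp [T, SimpleGraph.fromRel_adj]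

theorem T_adj_some_some {a b c : ℕ} (i j : Fin 3) (k : Fin (![a, b, c] i))
    (l : Fin (![a, b, c] j)) :
    (T a b c).Adj (some ⟨i, k⟩) (some ⟨j, l⟩) ↔
      i = j ∧ (k.val + 1 = l.val ∨ l.val + 1 = k.val) := by
  simp only [T, SimpleGraph.fromRel_adj, ne_eq, Option.some.injEq]
  constructor
  · rintro ⟨-, ⟨h, h'⟩ | ⟨h, h'⟩⟩
    · exact ⟨h, Or.inl h'⟩
    · exact ⟨h.symm, Or.inr h'⟩
  · rintro ⟨rfl, h⟩
    refine ⟨fun e => ?_, ?_⟩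
    · have : k = l := by simpa using e
      subst this
      omega
    · rcases h with h | h
      · exact Or.inl ⟨rfl, h⟩
      · exact Or.inr ⟨rfl, h⟩

/-- The vertex of `T a b c` at distance `k` from the centre on the `i`-th arm. -/
def T.vertex (a b c : ℕ) (i : Fin 3) (k : ℕ) : Option (Σ i : Fin 3, Fin (![a, b, c] i)) :=
  if h : 1 ≤ k ∧ k - 1 < ![a, b, c] i then some ⟨i, ⟨k - 1, h.2⟩⟩ else none

theorem T.vertex_zero (a b c : ℕ) (i : Fin 3) : T.vertex a b c i 0 = none := by
  simp [T.vertex]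

theorem T.vertex_succ {a b c : ℕ} {i : Fin 3} {k : ℕ} (h : k < ![a, b, c] i) :
    T.vertex a b c i (k + 1) = some ⟨i, ⟨k, h⟩⟩ := by
  simp [T.vertex, h]

theorem T.nonBacktracking (a b c : ℕ) (i : Fin 3) :
    NonBacktracking (T a b c) (T.vertex a b c i) (![a, b, c] i) := by
  constructor
  · intro k hk
    rw [T.vertex_succ hk]
    rcases k with _ | k
    · rw [T.vertex_zero, T_adj_none_some]
    · rw [T.vertex_succ (by omega : k < _), T_adj_some_some]
      exact ⟨rfl, Or.inl rfl⟩
  · intro k hk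
    rw [T.vertex_succ (by omega : k + 1 < _)]
    rcases k with _ | k
    · simp [T.vertex_zero]
    · rw [T.vertex_succ (by omega : k < _)]
      simp only [ne_eq, Option.some.injEq, Sigma.mk.injEq, heq_eq_eq, Fin.mk.injEq, true_and]
      omega

theorem T_subharmonic {a b c : ℕ} {l : ℝ} (hl : 2 ≤ l) (ha : 1 ≤ a) (hb : 1 ≤ b) (hc : 1 ≤ c)
    (h : l ≤ armRatio l a + armRatio l b + armRatio l c) : Subharmonic (T a b c) l := by
  have hL : ∀ i, 1 ≤ ![a, b, c] i := by simp [Fin.forall_fin_succ, ha, hb, hc]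
  refine Subharmonic.of_branch (v := none) (u := fun i => T.vertex a b c i 1)
    (r := fun i => armRatio l (![a, b, c] i)) ?_ ?_ (by simpa [Fin.sum_univ_three] using h) ?_
  · intro i j hij
    simp only [T.vertex_succ (hL _)] at hij
    simpa using congrArg (Option.map Sigma.fst) hij
  · intro i
    simpa [T.vertex_zero] using (T.nonBacktracking a b c i).adj 0 (hL i)
  · intro i
    obtain ⟨n, hn⟩ := Nat.exists_eq_add_of_le' (hL i)
    have := T.nonBacktracking a b c i
    rw [hn] at this ⊢
    simpa [T.vertex_zero] using this.branch hl

theorem T_connected (a b c : ℕ) : (T a b c).Connected := by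
  have key : ∀ i k, k ≤ ![a, b, c] i → (T a b c).Reachable none (T.vertex a b c i k) := by
    intro i k hk
    induction k with
    | zero => rw [T.vertex_zero]
    | succ k ih =>
      exact (ih (by omega)).trans ((T.nonBacktracking a b c i).adj k (by omega)).reachable
  have key' : ∀ u, (T a b c).Reachable none u := by
    rintro (_ | ⟨i, k⟩)
    · rfl
    · have := key i (k + 1) k.2
      rwa [T.vertex_succ k.2] at this
  have : Nonempty (Option (Σ i : Fin 3, Fin (![a, b, c] i))) := ⟨none⟩
  exact ⟨fun u v => (key' u).symm.trans (key' v)⟩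

theorem armRatio_pos {l : ℝ} (hl : 2 ≤ l) {k : ℕ} (hk : 1 ≤ k) : 0 < armRatio l k := by
  obtain ⟨k, rfl⟩ := Nat.exists_eq_add_of_le' hk
  have := (armRatio_nonneg_lt_one hl k).2
  rw [armRatio]
  have : 0 < l - armRatio l k := by linarith
  positivity

/-- The value, at distance `k` from the start, of the solution of `x (k - 1) + x (k + 1) = l x k`
with `x 0 = 1` and `x (n + 1) = 0`. -/
noncomputable def armProfile (l : ℝ) (n k : ℕ) : ℝ :=
  ∏ j ∈ Finset.range k, armRatio l (n - j)

theorem armProfile_succ (l : ℝ) (n k : ℕ) :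
    armProfile l n (k + 1) = armProfile l n k * armRatio l (n - k) := by
  rw [armProfile, Finset.prod_range_succ, armProfile]

theorem armProfile_pos {l : ℝ} (hl : 2 ≤ l) {n k : ℕ} (hk : k ≤ n) : 0 < armProfile l n k := by
  refine Finset.prod_pos fun j hj => armRatio_pos hl ?_
  have := Finset.mem_range.mp hj
  omega

theorem armProfile_add {l : ℝ} (hl : 2 ≤ l) {n k : ℕ} (hk : k < n) :
    armProfile l n k + armProfile l n (k + 2) = l * armProfile l n (k + 1) := by
  obtain ⟨m, rfl⟩ := Nat.exists_eq_add_of_lt hk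
  rw [armProfile_succ l _ (k + 1), armProfile_succ, show k + m + 1 - k = m + 1 by omega,
    show k + m + 1 - (k + 1) = m by omega]
  have h := (armRatio_nonneg_lt_one hl m).2
  have h2 : l - armRatio l m ≠ 0 := by linarith
  rw [armRatio]
  field_simp
  ring

theorem armProfile_self_succ (l : ℝ) (n : ℕ) : armProfile l n (n + 1) = 0 := by
  rw [armProfile_succ]
  simp [armRatio]

theorem adjSum_le_sum_of_subset {V : Type*} [Fintype V] {G : SimpleGraph V} {x : V → ℝ}
    (hx : ∀ v, 0 ≤ x v) {u : V} {S : Finset V} (h : ∀ v, G.Adj u v → v ∈ S) :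
    adjSum G x u ≤ ∑ v ∈ S, x v := by
  rw [adjSum, ← Finset.sum_filter]
  exact Finset.sum_le_sum_of_subset_of_nonneg
    (fun v hv => h v (Finset.mem_filter.mp hv).2) fun v _ _ => hx v

/-- The function on `T a b c` given on each arm by the solution vanishing just past its end. -/
noncomputable def starWeight (a b c : ℕ) (l : ℝ) :
    Option (Σ i : Fin 3, Fin (![a, b, c] i)) → ℝ
  | none => 1
  | some ⟨i, k⟩ => armProfile l (![a, b, c] i) (k + 1)

theorem starWeight_pos {a b c : ℕ} {l : ℝ} (hl : 2 ≤ l)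
    (u : Option (Σ i : Fin 3, Fin (![a, b, c] i))) : 0 < starWeight a b c l u := by
  rcases u with _ | ⟨i, k⟩
  · exact one_pos
  · exact armProfile_pos hl k.2

theorem starWeight_vertex {a b c : ℕ} {l : ℝ} {i : Fin 3} {k : ℕ} (hk : k ≤ ![a, b, c] i) :
    starWeight a b c l (T.vertex a b c i k) = armProfile l (![a, b, c] i) k := by
  rcases k with _ | k
  · simp [T.vertex_zero, starWeight, armProfile]
  · rw [T.vertex_succ hk, starWeight]

theorem T_adj_some_eq {a b c : ℕ} {i : Fin 3} {k : Fin (![a, b, c] i)}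
    {v : Option (Σ i : Fin 3, Fin (![a, b, c] i))} (h : (T a b c).Adj (some ⟨i, k⟩) v) :
    v = T.vertex a b c i k ∨
      (k.val + 1 < ![a, b, c] i ∧ v = T.vertex a b c i (k + 2)) := by
  rcases v with _ | ⟨j, m⟩
  · rw [SimpleGraph.adj_comm, T_adj_none_some] at h
    left
    rw [h, T.vertex_zero]
  · rw [T_adj_some_some] at h
    obtain ⟨rfl, h | h⟩ := h
    · right
      refine ⟨by omega, ?_⟩
      rw [T.vertex_succ (by omega : k.val + 1 < _)]
      simp [h]
    · left
      rw [← h, T.vertex_succ (by omega : m.val < _)]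

/-- `starWeight` obeys the recurrence along each arm, also at its end because the profile vanishes
one step further. At the centre the neighbours contribute the three ratios, which is the hypothesis.
-/
theorem T_superharmonic {a b c : ℕ} {l : ℝ} (hl : 2 ≤ l) (ha : 1 ≤ a) (hb : 1 ≤ b) (hc : 1 ≤ c)
    (h : armRatio l a + armRatio l b + armRatio l c ≤ l) : Superharmonic (T a b c) l := by
  have hL : ∀ i, 1 ≤ ![a, b, c] i := by simp [Fin.forall_fin_succ, ha, hb, hc]
  have hnn : ∀ u, 0 ≤ starWeight a b c l u := fun u => (starWeight_pos hl u).le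
  refine ⟨starWeight a b c l, starWeight_pos hl, fun u => ?_⟩
  change adjSum (T a b c) _ _ ≤ _
  rcases u with _ | ⟨i, k⟩
  · refine (adjSum_le_sum_of_subset hnn
      (S := Finset.univ.image fun i => T.vertex a b c i 1) ?_).trans ?_
    · rintro (_ | ⟨i, k⟩) hv
      · exact absurd hv (SimpleGraph.irrefl _)
      · rw [T_adj_none_some] at hv
        refine Finset.mem_image.mpr ⟨i, Finset.mem_univ i, ?_⟩
        rw [T.vertex_succ (hL i)]
        simp [Fin.ext_iff, hv]
    · rw [Finset.sum_image]
      · simp only [starWeight_vertex (hL _), armProfile_succ l _ 0]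
        simpa [armProfile, Fin.sum_univ_three, starWeight] using h
      · intro i _ j _ hij
        simp only [T.vertex_succ (hL _)] at hij
        simpa using congrArg (Option.map Sigma.fst) hij
  · have hk := k.2
    by_cases hk' : k.val + 1 < ![a, b, c] i
    · refine (adjSum_le_sum_of_subset hnn
        (S := {T.vertex a b c i k, T.vertex a b c i (k + 2)}) ?_).trans ?_
      · intro v hv
        rcases T_adj_some_eq hv with h | h <;> simp [h]
      · rw [Finset.sum_pair, starWeight_vertex hk.le, starWeight_vertex (by omega), starWeight,
          armProfile_add hl hk]
        exact ((T.nonBacktracking a b c i).ne k (by omega)).symm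
    · refine (adjSum_le_sum_of_subset hnn (S := {T.vertex a b c i k}) ?_).trans ?_
      · intro v hv
        rcases T_adj_some_eq hv with h | h
        · simp [h]
        · exact absurd h.1 hk'
      · have := armProfile_self_succ l (![a, b, c] i)
        rw [Finset.sum_singleton, starWeight_vertex hk.le, starWeight, ← armProfile_add hl hk,
          show k.val + 2 = ![a, b, c] i + 1 by omega, this, add_zero]

theorem T_adjSum_one_le {a b c : ℕ} {u : Option (Σ i : Fin 3, Fin (![a, b, c] i))}
    (hu : u ≠ none) : (∑ v, if (T a b c).Adj u v then (1 : ℝ) else 0) ≤ 2 := by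
  change adjSum (T a b c) (fun _ => 1) u ≤ 2
  rcases u with _ | ⟨i, k⟩
  · exact absurd rfl hu
  · refine (adjSum_le_sum_of_subset (by simp)
      (S := {T.vertex a b c i k, T.vertex a b c i (k + 2)}) ?_).trans ?_
    · intro v hv
      rcases T_adj_some_eq hv with h | h <;> simp [h]
    · rw [Finset.sum_const, nsmul_eq_mul, mul_one]
      exact_mod_cast Finset.card_le_two

theorem adjSum_comp_iso {V W : Type*} [Fintype V] [Fintype W] {G : SimpleGraph V}
    {H : SimpleGraph W} (e : G ≃g H) (x : W → ℝ) (u : V) :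
    adjSum G (fun v => x (e v)) u = adjSum H x (e u) := by
  rw [adjSum, adjSum, ← e.toEquiv.sum_comp]
  refine Finset.sum_congr rfl fun v _ => ?_
  have : H.Adj (e u) (e v) ↔ G.Adj u v := e.map_rel_iff
  change _ = if H.Adj (e u) (e v) then x (e v) else 0
  simp only [this]

theorem Superharmonic.of_iso {V W : Type*} [Fintype V] [Fintype W] {G : SimpleGraph V}
    {H : SimpleGraph W} (e : G ≃g H) {l : ℝ} (h : Superharmonic H l) : Superharmonic G l := by
  obtain ⟨w, hw, hle⟩ := h
  exact ⟨fun v => w (e v), fun v => hw _, fun u => (adjSum_comp_iso e w u).trans_le (hle _)⟩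

theorem Subharmonic.of_iso {V W : Type*} [Fintype V] [Fintype W] {G : SimpleGraph V}
    {H : SimpleGraph W} (e : G ≃g H) {l : ℝ} (h : Subharmonic H l) : Subharmonic G l := by
  obtain ⟨w, hw, h0, hle⟩ := h
  obtain ⟨y, hy⟩ := Function.ne_iff.mp hw
  refine ⟨fun v => w (e v), Function.ne_iff.mpr ⟨e.symm y, by simpa using hy⟩, fun v => h0 _,
    fun u => (hle _).trans_eq (adjSum_comp_iso e w u).symm⟩

end Starlike

/-! ### Recognising a starlike tree from its arms. -/

section Arms

/-- Geodesics through `y` and through `z` are both the unique path from `v` to `x`, so their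
penultimate vertices agree. -/
theorem eq_of_adj_of_dist_eq {V : Type*} {G : SimpleGraph V} (hG : G.IsTree) {v x y z : V}
    (hy : G.Adj x y) (hz : G.Adj x z) (hdy : G.dist v x = G.dist v y + 1)
    (hdz : G.dist v x = G.dist v z + 1) : y = z := by
  obtain ⟨p, hp⟩ := hG.1.exists_walk_length_eq_dist v y
  obtain ⟨q, hq⟩ := hG.1.exists_walk_length_eq_dist v z
  have hp' : (p.concat hy.symm).IsPath :=
    SimpleGraph.Walk.isPath_of_length_eq_dist _ (by rw [SimpleGraph.Walk.length_concat]; omega)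
  have hq' : (q.concat hz.symm).IsPath :=
    SimpleGraph.Walk.isPath_of_length_eq_dist _ (by rw [SimpleGraph.Walk.length_concat]; omega)
  have := (hG.existsUnique_path v x).unique hp' hq'
  simpa using congrArg SimpleGraph.Walk.penultimate this

theorem NonBacktracking.dist_eq {V : Type*} {G : SimpleGraph V} (hG : G.IsTree)
    {q : ℕ → V} {n : ℕ} (h : NonBacktracking G q n) {k : ℕ} (hk : k ≤ n) :
    G.dist (q 0) (q k) = k := by
  induction k using Nat.strong_induction_on with
  | _ k ih =>
    match k with
    | 0 => simp
    | 1 => exact SimpleGraph.dist_eq_one_iff_adj.mpr (h.adj 0 (by omega))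
    | k + 2 =>
      have h0 := ih k (by omega) (by omega)
      have h1 := ih (k + 1) (by omega) (by omega)
      rcases hG.dist_eq_dist_add_one_of_adj (q 0) (h.adj (k + 1) (by omega)) with h2 | h2
      · exact absurd (eq_of_adj_of_dist_eq hG (h.adj (k + 1) (by omega)) (h.adj k (by omega)).symm
          h2 (by rw [h0, h1])) (h.ne k hk)
      · rw [h2, h1]

/-- A non-backtracking sequence of `n ≥ 1` steps that cannot be prolonged. -/
structure IsArm {V : Type*} (G : SimpleGraph V) (q : ℕ → V) (n : ℕ) : Prop where
  nonBacktracking : NonBacktracking G q n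
  one_le : 1 ≤ n
  eq_of_adj : ∀ z, G.Adj (q n) z → z = q (n - 1)

/-- If prolongation never stopped there would be non-backtracking walks of any length; in a tree
their vertices lie at distinct distances from the start, against finiteness. -/
theorem exists_isArm {V : Type*} [Fintype V] {G : SimpleGraph V} (hG : G.IsTree) {v w : V}
    (hvw : G.Adj v w) : ∃ q n, IsArm G q n ∧ q 0 = v ∧ q 1 = w := by
  by_contra hno
  have key : ∀ n, ∃ q, NonBacktracking G q (n + 1) ∧ q 0 = v ∧ q 1 = w := by
    intro n
    induction n with
    | zero =>
      refine ⟨fun k => if k = 0 then v else w, ⟨fun k hk => ?_, fun k hk => by omega⟩, rfl, rfl⟩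
      obtain rfl : k = 0 := by omega
      simpa using hvw
    | succ n ih =>
      obtain ⟨q, hq, h0, h1⟩ := ih
      obtain ⟨z, hz, hne⟩ : ∃ z, G.Adj (q (n + 1)) z ∧ z ≠ q n := by
        by_contra! hall
        exact hno ⟨q, n + 1, ⟨hq, by omega, hall⟩, h0, h1⟩
      refine ⟨Function.update q (n + 2) z, ⟨fun k hk => ?_, fun k hk => ?_⟩, ?_, ?_⟩
      · rw [Function.update_of_ne (by omega)]
        rcases Nat.lt_or_ge k (n + 1) with hk' | hk'
        · rw [Function.update_of_ne (by omega)]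
          exact hq.adj k hk'
        · obtain rfl : k = n + 1 := by omega
          rwa [Function.update_self]
      · rw [Function.update_of_ne (a := k) (by omega)]
        rcases Nat.lt_or_ge k n with hk' | hk'
        · rw [Function.update_of_ne (by omega)]
          exact hq.ne k (by omega)
        · obtain rfl : k = n := by omega
          rwa [Function.update_self]
      · rwa [Function.update_of_ne (by omega)]
      · rwa [Function.update_of_ne (by omega)]
  obtain ⟨q, hq, -, -⟩ := key (Fintype.card V)
  have hinj : Function.Injective fun k : Fin (Fintype.card V + 1) => q k := by
    intro i j hij
    have hi := hq.dist_eq hG (k := i) (by omega)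
    have hj := hq.dist_eq hG (k := j) (by omega)
    simp only at hij
    rw [hij] at hi
    exact Fin.ext (hi.symm.trans hj)
  have := Fintype.card_le_of_injective _ hinj
  simp at this

/-- Arms with different first steps meet only at `v`, by tracing a common vertex back towards `v`.
The degree bounds leave no other edges, so the arms are closed under adjacency and fill the
connected graph. -/
theorem iso_T_of_arms {V : Type*} [Fintype V] {G : SimpleGraph V} (hG : G.IsTree) {v : V}
    (hv : G.degree v = 3) (hdeg : ∀ u, u ≠ v → G.degree u ≤ 2) {a b c : ℕ} {q : Fin 3 → ℕ → V}
    (hq : ∀ i, IsArm G (q i) (![a, b, c] i)) (h0 : ∀ i, q i 0 = v)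
    (h1 : Function.Injective fun i => q i 1) : Nonempty (G ≃g T a b c) := by
  have hdist : ∀ i k, k ≤ ![a, b, c] i → G.dist v (q i k) = k := fun i k hk => by
    have := (hq i).nonBacktracking.dist_eq hG hk
    rwa [h0] at this
  have hinj : ∀ k i j, 1 ≤ k → k ≤ ![a, b, c] i → k ≤ ![a, b, c] j → q i k = q j k → i = j := by
    intro k
    induction k with
    | zero => intro i j h; omega
    | succ k ih =>
      intro i j _ hi hj he
      rcases Nat.eq_zero_or_pos k with rfl | hk
      · exact h1 he
      · refine ih i j hk (by omega) (by omega) ?_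
        refine eq_of_adj_of_dist_eq hG (v := v) (x := q i (k + 1))
          ((hq i).nonBacktracking.adj k hi).symm ?_ ?_ ?_
        · rw [he]; exact ((hq j).nonBacktracking.adj k hj).symm
        · rw [hdist i _ hi, hdist i _ (by omega)]
        · rw [hdist i _ hi, hdist j _ (by omega)]
  have hinj' : ∀ {i j k m}, 1 ≤ k → k ≤ ![a, b, c] i → m ≤ ![a, b, c] j → q i k = q j m →
      i = j ∧ k = m := by
    intro i j k m hk hi hj he
    have : k = m := by rw [← hdist i k hi, he, hdist j m hj]
    subst this
    exact ⟨hinj k i j hk hi hj he, rfl⟩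
  have hnbr : ∀ {i k z}, k < ![a, b, c] i → G.Adj (q i (k + 1)) z →
      z = q i k ∨ (k + 1 < ![a, b, c] i ∧ z = q i (k + 2)) := by
    intro i k z hk hz
    rcases Nat.lt_or_ge (k + 1) (![a, b, c] i) with hlt | hge
    · by_contra! hcon
      have hne : q i (k + 1) ≠ v := fun h => by
        have := hdist i (k + 1) (by omega)
        rw [h, SimpleGraph.dist_self] at this
        omega
      refine (hdeg _ hne).not_gt ?_
      rw [← SimpleGraph.card_neighborFinset_eq_degree, Finset.two_lt_card]
      refine ⟨z, by simpa using hz, q i k, ?_, q i (k + 2), ?_, hcon.1, hcon.2 hlt, ?_⟩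
      · simpa using ((hq i).nonBacktracking.adj k (by omega)).symm
      · simpa using (hq i).nonBacktracking.adj (k + 1) hlt
      · exact ((hq i).nonBacktracking.ne k (by omega)).symm
    · have hn : ![a, b, c] i = k + 1 := by omega
      have := (hq i).eq_of_adj z (by rwa [hn])
      rw [hn] at this
      exact Or.inl this
  have hnbr0 : ∀ {z}, G.Adj v z → ∃ i, z = q i 1 := by
    intro z hz
    have hsub : Finset.univ.image (fun i => q i 1) ⊆ G.neighborFinset v := by
      intro y hy
      obtain ⟨i, -, rfl⟩ := Finset.mem_image.mp hy
      have := (hq i).nonBacktracking.adj 0 (hq i).one_le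
      rw [h0] at this
      simpa using this
    have heq := Finset.eq_of_subset_of_card_le hsub (by
      rw [SimpleGraph.card_neighborFinset_eq_degree, hv, Finset.card_image_of_injective _ h1]
      simp)
    have : z ∈ G.neighborFinset v := by simpa using hz
    rw [← heq] at this
    obtain ⟨i, -, hi⟩ := Finset.mem_image.mp this
    exact ⟨i, hi.symm⟩
  let f : Option (Σ i : Fin 3, Fin (![a, b, c] i)) → V
    | none => v
    | some ⟨i, k⟩ => q i (k + 1)
  have hfinj : Function.Injective f := by
    rintro (_ | ⟨i, k⟩) (_ | ⟨j, m⟩) h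
    · rfl
    · have h' : v = q j (m + 1) := h
      have := hdist j (m + 1) m.2
      rw [← h', SimpleGraph.dist_self] at this
      omega
    · have h' : q i (k + 1) = v := h
      have := hdist i (k + 1) k.2
      rw [h', SimpleGraph.dist_self] at this
      omega
    · have h' : q i (k + 1) = q j (m + 1) := h
      obtain ⟨rfl, hkm⟩ := hinj' (by omega) k.2 m.2 h'
      have : k = m := Fin.ext (by omega)
      rw [this]
  have hfsurj : Function.Surjective f := by
    have hmem : ∀ i k, k ≤ ![a, b, c] i → q i k ∈ Set.range f := by
      intro i k hk
      rcases k with _ | k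
      · exact ⟨none, (h0 i).symm⟩
      · exact ⟨some ⟨i, ⟨k, hk⟩⟩, rfl⟩
    intro z
    refine eq_univ_of_adj_closed hG.1 (S := Set.range f) ⟨v, none, rfl⟩ ?_ z
    rintro _ ⟨_ | ⟨i, k⟩, rfl⟩ z hz
    · obtain ⟨i, rfl⟩ := hnbr0 hz
      exact hmem i 1 (hq i).one_le
    · rcases hnbr k.2 hz with rfl | ⟨hk, rfl⟩
      · exact hmem i k k.2.le
      · exact hmem i _ (by omega)
  have hadj0 : ∀ i (k : Fin (![a, b, c] i)), G.Adj v (q i (k + 1)) ↔ k.val = 0 := by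
    intro i k
    constructor
    · intro h
      have h2 := SimpleGraph.dist_eq_one_iff_adj.mpr h
      rw [hdist i _ k.2] at h2
      omega
    · intro h
      have := (hq i).nonBacktracking.adj 0 (hq i).one_le
      rwa [h0, ← h] at this
  refine ⟨(⟨Equiv.ofBijective f ⟨hfinj, hfsurj⟩, ?_⟩ : T a b c ≃g G).symm⟩
  intro x y
  change G.Adj (f x) (f y) ↔ _
  rcases x with _ | ⟨i, k⟩ <;> rcases y with _ | ⟨j, m⟩
  · simp
  · rw [T_adj_none_some]; exact hadj0 j m
  · rw [SimpleGraph.adj_comm, SimpleGraph.adj_comm (T a b c), T_adj_none_some]; exact hadj0 i k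
  · rw [T_adj_some_some]
    change G.Adj (q i (k + 1)) (q j (m + 1)) ↔ _
    constructor
    · intro h
      rcases hnbr k.2 h with h | ⟨hk, h⟩
      · obtain ⟨rfl, h'⟩ := hinj' (by omega) m.2 k.2.le h
        exact ⟨rfl, Or.inr h'⟩
      · obtain ⟨rfl, h'⟩ := hinj' (by omega) m.2 (by omega) h
        exact ⟨rfl, Or.inl (by omega)⟩
    · rintro ⟨rfl, h | h⟩
      · rw [← h]
        exact (hq i).nonBacktracking.adj (k + 1) (by omega)
      · rw [← h]
        exact ((hq i).nonBacktracking.adj (m + 1) (by omega)).symm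

theorem exists_iso_T {V : Type*} [Fintype V] {G : SimpleGraph V} (hG : G.IsTree) {v : V}
    (hv : G.degree v = 3) (hdeg : ∀ u, u ≠ v → G.degree u ≤ 2) :
    ∃ a b c, 1 ≤ a ∧ a ≤ b ∧ b ≤ c ∧ Nonempty (G ≃g T a b c) := by
  rw [← SimpleGraph.card_neighborFinset_eq_degree, Finset.card_eq_three] at hv
  obtain ⟨x, y, z, hxy, hxz, hyz, he⟩ := hv
  have hv : G.degree v = 3 := by
    rw [← SimpleGraph.card_neighborFinset_eq_degree, he, Finset.card_eq_three]
    exact ⟨x, y, z, hxy, hxz, hyz, rfl⟩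
  have hadj : ∀ u ∈ ({x, y, z} : Finset V), ∃ q n, IsArm G q n ∧ q 0 = v ∧ q 1 = u := by
    intro u hu
    rw [← he, SimpleGraph.mem_neighborFinset] at hu
    exact exists_isArm hG hu
  obtain ⟨qx, nx, hx, hx0, hx1⟩ := hadj x (by simp)
  obtain ⟨qy, ny, hy, hy0, hy1⟩ := hadj y (by simp)
  obtain ⟨qz, nz, hz, hz0, hz1⟩ := hadj z (by simp)
  have key : ∀ {p q r : ℕ → V} {a b c : ℕ}, IsArm G p a → IsArm G q b → IsArm G r c →
      p 0 = v → q 0 = v → r 0 = v → p 1 ≠ q 1 → p 1 ≠ r 1 → q 1 ≠ r 1 → a ≤ b → b ≤ c →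
      ∃ a b c, 1 ≤ a ∧ a ≤ b ∧ b ≤ c ∧ Nonempty (G ≃g T a b c) := by
    intro p q r a b c hp hq hr hp0 hq0 hr0 h1 h2 h3 hab hbc
    refine ⟨a, b, c, hp.one_le, hab, hbc, iso_T_of_arms hG hv hdeg (q := ![p, q, r]) ?_ ?_ ?_⟩
    · simp [Fin.forall_fin_succ, hp, hq, hr]
    · simp [Fin.forall_fin_succ, hp0, hq0, hr0]
    · convert injective_triple h1 h2 h3 using 1
      funext i
      fin_cases i <;> rfl
  subst hx1 hy1 hz1
  rcases le_total nx ny with h1 | h1 <;> rcases le_total ny nz with h2 | h2 <;>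
    rcases le_total nx nz with h3 | h3
  · exact key hx hy hz hx0 hy0 hz0 hxy hxz hyz h1 h2
  · exact key hx hy hz hx0 hy0 hz0 hxy hxz hyz h1 h2
  · exact key hx hz hy hx0 hz0 hy0 hxz hxy hyz.symm h3 h2
  · exact key hz hx hy hz0 hx0 hy0 hxz.symm hyz.symm hxy h3 h1
  · exact key hy hx hz hy0 hx0 hz0 hxy.symm hyz hxz h1 h3
  · exact key hy hz hx hy0 hz0 hx0 hyz hxy.symm hxz.symm h2 h3
  · exact key hz hy hx hz0 hy0 hx0 hyz.symm hxz.symm hxy.symm h2 h1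
  · exact key hz hy hx hz0 hy0 hx0 hyz.symm hxz.symm hxy.symm h2 h1

end Arms

end GraphMahler

/-! ### Case analysis of connected graphs. -/

namespace GraphMahler

open Polynomial
open scoped Classical

section Connected

variable {V : Type*} [Fintype V] {G : SimpleGraph V}

/-- The number of neighbours of `v` that have degree at least two. -/
noncomputable def innerDegree (G : SimpleGraph V) (v : V) : ℕ :=
  {u ∈ G.neighborFinset v | 2 ≤ G.degree u}.card

theorem innerDegree_le_degree (v : V) : innerDegree G v ≤ G.degree v :=
  Finset.card_filter_le _ _

theorem superharmonic_two_of_degree_add_innerDegree_le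
    (h : ∀ v, 2 ≤ G.degree v → G.degree v + innerDegree G v ≤ 4) : Superharmonic G 2 := by
  refine ⟨fun v => if 2 ≤ G.degree v then 2 else 1, fun v => by
    beta_reduce; split_ifs <;> norm_num, fun u => ?_⟩
  have e : (∑ v, if G.Adj u v then (if 2 ≤ G.degree v then (2 : ℝ) else 1) else 0) =
      (G.degree u + innerDegree G u : ℕ) := by
    rw [← Finset.sum_filter, ← SimpleGraph.neighborFinset_eq_filter, innerDegree,
      ← SimpleGraph.card_neighborFinset_eq_degree, Finset.card_filter, Finset.card_eq_sum_ones,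
      ← Finset.sum_add_distrib, Nat.cast_sum]
    refine Finset.sum_congr rfl fun v _ => ?_
    split_ifs <;> norm_num
  rw [e]
  beta_reduce
  split_ifs with hu
  · exact_mod_cast h u hu
  · have := innerDegree_le_degree (G := G) u
    have h2 : G.degree u + innerDegree G u ≤ 2 := by omega
    rw [mul_one]
    exact_mod_cast h2

theorem branch_of_two_le_degree {l : ℝ} (hl : 2 ≤ l) {v w : V} (hvw : G.Adj v w)
    (hw : 2 ≤ G.degree w) : Branch G l v w (armRatio l 2) := by
  rw [← SimpleGraph.card_neighborFinset_eq_degree] at hw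
  obtain ⟨u, hu, hne⟩ := Finset.exists_mem_ne hw v
  refine Branch.step hvw (by simpa using hu) hne ?_ ?_
  · linarith [(armRatio_nonneg_lt_one hl 1).2]
  · simpa [armRatio] using Branch.leaf (G := G) (l := l) (by linarith) (by simpa using hu)

/-- Each neighbour gives an arm of one vertex, or of two if it is not a leaf. The worst case is
degree four with one non-leaf neighbour. -/
theorem subharmonic_of_four_le_degree {v : V} (h4 : 4 ≤ G.degree v)
    (h5 : 5 ≤ G.degree v + innerDegree G v) : Subharmonic G (61 / 30) := by
  refine Subharmonic.of_branch (v := v) (ι := G.neighborFinset v) (u := Subtype.val)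
    (r := fun u => armRatio (61 / 30) 1 +
      if 2 ≤ G.degree u.1 then armRatio (61 / 30) 2 - armRatio (61 / 30) 1 else 0)
    Subtype.val_injective (fun u => (G.mem_neighborFinset v _).mp u.2) ?_ ?_
  · rw [Finset.sum_coe_sort (G.neighborFinset v) fun u => armRatio (61 / 30) 1 +
      if 2 ≤ G.degree u then armRatio (61 / 30) 2 - armRatio (61 / 30) 1 else 0,
      Finset.sum_add_distrib, ← Finset.sum_filter, Finset.sum_const, Finset.sum_const,
      SimpleGraph.card_neighborFinset_eq_degree, nsmul_eq_mul, nsmul_eq_mul]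
    change _ ≤ _ + (innerDegree G v : ℝ) * _
    have h4' : (4 : ℝ) ≤ G.degree v := by exact_mod_cast h4
    have h5' : (5 : ℝ) ≤ G.degree v + innerDegree G v := by exact_mod_cast h5
    norm_num [armRatio]
    linarith
  · intro u
    have hu : G.Adj v u := (G.mem_neighborFinset v _).mp u.2
    split_ifs with h
    · simpa using branch_of_two_le_degree (by norm_num) hu h
    · simpa [armRatio] using Branch.leaf (l := 61 / 30) (by norm_num) hu

/-- At `l = 265/132 = 12/11 + 11/12` the value `11/12` is a fixed point of `r ↦ 1 / (l - r)`. The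
fork starts above it, so the bound survives a path of any length. -/
theorem branch_of_path_to_fork {a b u : V} (hab : G.Adj a b) (p : G.Walk b u)
    (hp : (SimpleGraph.Walk.cons hab p).IsPath) (hu : 3 ≤ G.degree u) :
    Branch G (265 / 132) a b (11 / 12) := by
  induction p generalizing a with
  | nil =>
    rename_i b
    rw [← SimpleGraph.card_neighborFinset_eq_degree] at hu
    have h1 : 1 < ((G.neighborFinset b).erase a).card := by
      have := Finset.pred_card_le_card_erase (s := G.neighborFinset b) (a := a)
      omega
    obtain ⟨x, hx, y, hy, hxy⟩ := Finset.one_lt_card.mp h1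
    simp only [Finset.mem_erase, SimpleGraph.mem_neighborFinset] at hx hy
    exact (Branch.fork (by norm_num) hab hx.2 hy.2 hxy hx.1 hy.1).mono (by norm_num)
  | cons hbc p ih =>
    rename_i b c u
    have hbr := ih hbc hp.of_cons hu
    have hca : c ≠ a := by
      rintro rfl
      have := (SimpleGraph.Walk.cons_isPath_iff _ _).mp hp
      exact this.2 (by simp)
    exact (Branch.step hab hbc hca (by norm_num) hbr).mono (by norm_num)

theorem subharmonic_of_two_forks (hG : G.Connected) {v u : V} (hv : G.degree v = 3)
    (hv' : 2 ≤ innerDegree G v) (huv : u ≠ v) (hu : 3 ≤ G.degree u) :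
    Subharmonic G (265 / 132) := by
  obtain ⟨p, hp⟩ := (hG.preconnected v u).exists_isPath
  cases p with
  | nil => exact absurd rfl huv
  | cons hvb p =>
    rename_i b
    have hb := branch_of_path_to_fork hvb p hp hu
    obtain ⟨c, hc, hcb⟩ := Finset.exists_mem_ne hv' b
    simp only [Finset.mem_filter, SimpleGraph.mem_neighborFinset] at hc
    obtain ⟨d, hd, hdb, hdc⟩ : ∃ d, G.Adj v d ∧ d ≠ b ∧ d ≠ c := by
      have h1 : ¬ G.neighborFinset v ⊆ {b, c} := fun hsub => by
        have := (Finset.card_le_card hsub).trans Finset.card_le_two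
        rw [SimpleGraph.card_neighborFinset_eq_degree] at this
        omega
      obtain ⟨d, hd, hd'⟩ := Finset.not_subset.mp h1
      simp only [Finset.mem_insert, Finset.mem_singleton, not_or,
        SimpleGraph.mem_neighborFinset] at hd hd'
      exact ⟨d, hd, hd'.1, hd'.2⟩
    refine Subharmonic.of_three_branches hvb hc.1 hd hcb.symm hdb.symm hdc.symm hb
      (branch_of_two_le_degree (by norm_num) hc.1 hc.2) (Branch.leaf (by norm_num) hd) ?_
    norm_num [armRatio]

/-- At `l = 2` the ratio of an arm of `k` vertices is `k / (k + 1)`, whence the affine cases `T 2 2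
2`, `T 1 3 3`, `T 1 2 5`. Minimal trees reaching `265/132` are `T 2 2 3`, `T 1 3 4`, `T 1 2 7`;
monotonicity of `armRatio` covers longer arms. -/
theorem T_cases {a b c : ℕ} (ha : 1 ≤ a) (hab : a ≤ b) (hbc : b ≤ c) :
    Superharmonic (T a b c) 2 ∨ Subharmonic (T a b c) (265 / 132) ∨ (a = 1 ∧ b = 2 ∧ c = 6) := by
  have h2 : (2 : ℝ) ≤ 265 / 132 := by norm_num
  have hm : ∀ {k n : ℕ}, k ≤ n → armRatio (265 / 132) k ≤ armRatio (265 / 132) n :=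
    fun h => armRatio_mono h2 h
  have hlt := fun k => (armRatio_nonneg_lt_one le_rfl k).2
  by_cases ha2 : 2 ≤ a
  · by_cases hc3 : 3 ≤ c
    · refine Or.inr (Or.inl (T_subharmonic h2 ha (by omega) (by omega) ?_))
      have h1 := hm ha2
      have h3 := hm (ha2.trans hab)
      have h4 := hm hc3
      norm_num [armRatio] at h1 h3 h4 ⊢
      linarith
    · obtain ⟨rfl, rfl, rfl⟩ : a = 2 ∧ b = 2 ∧ c = 2 := by omega
      exact Or.inl (T_superharmonic le_rfl (by norm_num) (by norm_num) (by norm_num)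
        (by norm_num [armRatio]))
  · obtain rfl : a = 1 := by omega
    by_cases hb3 : 3 ≤ b
    · by_cases hc4 : 4 ≤ c
      · refine Or.inr (Or.inl (T_subharmonic h2 ha (by omega) (by omega) ?_))
        have h3 := hm hb3
        have h4 := hm hc4
        norm_num [armRatio] at h3 h4 ⊢
        linarith
      · obtain ⟨rfl, rfl⟩ : b = 3 ∧ c = 3 := by omega
        exact Or.inl (T_superharmonic le_rfl (by norm_num) (by norm_num) (by norm_num)
          (by norm_num [armRatio]))
    · by_cases hb2 : b = 2
      · subst hb2
        rcases lt_trichotomy c 6 with hc | hc | hc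
        · refine Or.inl (T_superharmonic le_rfl ha (by omega) (by omega) ?_)
          have h5 := armRatio_mono (le_refl (2 : ℝ)) (by omega : c ≤ 5)
          norm_num [armRatio] at h5 ⊢
          linarith
        · exact Or.inr (Or.inr ⟨rfl, rfl, hc⟩)
        · refine Or.inr (Or.inl (T_subharmonic h2 ha (by omega) (by omega) ?_))
          have h7 := hm (by omega : 7 ≤ c)
          norm_num [armRatio] at h7 ⊢
          linarith
      · obtain rfl : b = 1 := by omega
        refine Or.inl (T_superharmonic le_rfl ha (by omega) (by omega) ?_)
        have := hlt c
        norm_num [armRatio]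
        linarith

/-- A connected graph has all its eigenvalues in `[-2, 2]`, or is `T 1 2 6`, or has eigenvalues
that are far from this interval. -/
theorem connected_cases (hG : G.Connected) :
    Superharmonic G 2 ∨ EigGe G (61 / 30) ∨ (EigGe G (265 / 132) ∧ EigLeNeg G (265 / 132)) ∨
      Nonempty (G ≃g T 1 2 6) := by
  by_cases h : ∀ v, 2 ≤ G.degree v → G.degree v + innerDegree G v ≤ 4
  · exact Or.inl (superharmonic_two_of_degree_add_innerDegree_le h)
  push Not at h
  obtain ⟨v, -, hv⟩ := h
  have hle := innerDegree_le_degree (G := G) v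
  by_cases h4 : 4 ≤ G.degree v
  · exact Or.inr (Or.inl (subharmonic_of_four_le_degree h4 hv).eigGe)
  -- Degree at most two is impossible, since `innerDegree` is at most the degree and the sum is at
  -- least `5`.
  have hv3 : G.degree v = 3 := by omega
  by_cases hac : G.IsAcyclic
  swap
  · exact Or.inr (Or.inl (subharmonic_of_not_isAcyclic hG hac (by omega : 2 < G.degree v)).eigGe)
  have hsub : Subharmonic G (265 / 132) → EigGe G (265 / 132) ∧ EigLeNeg G (265 / 132) :=
    fun hs => ⟨hs.eigGe, hs.eigGe.eigLeNeg hac.isBipartite⟩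
  by_cases hu : ∃ u, u ≠ v ∧ 3 ≤ G.degree u
  · obtain ⟨u, huv, hu⟩ := hu
    exact Or.inr (Or.inr (Or.inl (hsub (subharmonic_of_two_forks hG hv3 (by omega) huv hu))))
  push Not at hu
  obtain ⟨a, b, c, ha, hab, hbc, ⟨e⟩⟩ := exists_iso_T ⟨hG, hac⟩ hv3
    fun u huv => Nat.lt_succ_iff.mp (hu u huv)
  rcases T_cases ha hab hbc with h | h | ⟨rfl, rfl, rfl⟩
  · exact Or.inl (h.of_iso e)
  · exact Or.inr (Or.inr (Or.inl (hsub (h.of_iso e))))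
  · exact Or.inr (Or.inr (Or.inr ⟨e⟩))

end Connected

end GraphMahler

/-! ### Identification of `T 1 2 6` with `E 10`. -/

namespace GraphMahler

open Polynomial

section Coxeter

/-- A computable instance, so that `decide` can check all adjacencies in `nonempty_iso_E`. -/
instance (a b c : ℕ) : DecidableRel (T a b c).Adj := fun x y =>
  match x, y with
  | none, none => isFalse (SimpleGraph.irrefl _)
  | none, some ⟨i, k⟩ => decidable_of_iff _ (T_adj_none_some i k).symm
  | some ⟨i, k⟩, none =>
    decidable_of_iff _ ((T_adj_none_some i k).symm.trans (SimpleGraph.adj_comm _ _ _))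
  | some ⟨i, k⟩, some ⟨j, l⟩ => decidable_of_iff _ (T_adj_some_some i j k l).symm

instance (n : ℕ) : DecidableRel (E n).Adj :=
  inferInstanceAs (DecidableRel (SimpleGraph.fromRel _).Adj)

/-- The position in `E 10` of a vertex of `T 1 2 6`. -/
def coxeterVertex : Option (Σ i : Fin 3, Fin (![1, 2, 6] i)) → Fin 10
  | none => 2
  | some ⟨0, _⟩ => 9
  | some ⟨1, k⟩ => ⟨1 - k, by omega⟩
  | some ⟨2, k⟩ => ⟨3 + k, by have : k.val < 6 := k.2; omega⟩

theorem nonempty_iso_E : Nonempty (T 1 2 6 ≃g E 10) := by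
  have hinj : Function.Injective coxeterVertex := by unfold Function.Injective; decide
  have hbij : Function.Bijective coxeterVertex :=
    (Fintype.bijective_iff_injective_and_card _).mpr ⟨hinj, by decide⟩
  have hadj : ∀ x y, (E 10).Adj (coxeterVertex x) (coxeterVertex y) ↔ (T 1 2 6).Adj x y := by
    decide
  exact ⟨⟨Equiv.ofBijective _ hbij, hadj _ _⟩⟩

end Coxeter

/-! ### Lehmer's number and the eigenvalue equation of `T 1 2 6`. -/

section Lehmer

theorem aeval_lehmerPoly (x : ℝ) : aeval x lehmerPoly =
    x ^ 10 + x ^ 9 - x ^ 7 - x ^ 6 - x ^ 5 - x ^ 4 - x ^ 3 + x + 1 := by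
  simp [lehmerPoly]

/-- In the Taylor expansion at `11/10` all coefficients but the constant one are positive. This
makes a root beyond `11/10` the greatest one. -/
theorem aeval_lehmerPoly_lt {x y : ℝ} (hx : 11 / 10 ≤ x) (hxy : x < y) :
    aeval x lehmerPoly < aeval y lehmerPoly := by
  obtain ⟨u, hu⟩ : ∃ u, u = x - 11 / 10 := ⟨_, rfl⟩
  obtain ⟨v, hv⟩ : ∃ v, v = y - 11 / 10 := ⟨_, rfl⟩
  have hu0 : 0 ≤ u := by linarith
  have huv : u < v := by linarith
  have key : ∀ t : ℝ, aeval (t + 11 / 10) lehmerPoly = 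
      (-10741979489/10000000000) + 13833223/2500000 * t ^ 1 + 1739262041/20000000 * t ^ 2 +
      71823419/250000 * t ^ 3 + 50371707/100000 * t ^ 4 + 6966439/12500 * t ^ 5 +
      82113/200 * t ^ 6 + 5057/25 * t ^ 7 + 1287/20 * t ^ 8 + 12 * t ^ 9 + 1 * t ^ 10 := by
    intro t
    rw [aeval_lehmerPoly]
    ring
  rw [show x = u + 11 / 10 by linarith, show y = v + 11 / 10 by linarith, key, key]
  gcongr

theorem exists_isGreatest_lehmer : ∃ τ : ℝ,
    IsGreatest {x : ℝ | aeval x lehmerPoly = 0} τ ∧ 1.176280818 < τ ∧ τ < 1.176280819 := by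
  have h1 : aeval (1.176280818 : ℝ) lehmerPoly < 0 := by
    rw [aeval_lehmerPoly]; norm_num
  have h2 : 0 < aeval (1.176280819 : ℝ) lehmerPoly := by
    rw [aeval_lehmerPoly]; norm_num
  have hc : ContinuousOn (fun x : ℝ => aeval x lehmerPoly) (Set.Icc 1.176280818 1.176280819) :=
    (Polynomial.continuous_aeval _).continuousOn
  obtain ⟨τ, ⟨hτ1, hτ2⟩, hτ⟩ := intermediate_value_Ioo (by norm_num) hc ⟨h1, h2⟩
  refine ⟨τ, ⟨hτ, fun x hx => ?_⟩, hτ1, hτ2⟩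
  by_contra! hlt
  have h3 := aeval_lehmerPoly_lt (by norm_num at hτ1 ⊢; linarith) hlt
  have h4 : aeval x lehmerPoly = 0 := hx
  have h5 : aeval τ lehmerPoly = 0 := hτ
  rw [h4, h5] at h3
  exact lt_irrefl _ h3

/-- The recurrence with `l = s + 1 / s` has the solution `s ^ k - s ^ (-k)`, vanishing at `0`;
`armRatio` is the quotient of its values at `k` and `k + 1`. -/
theorem armRatio_add_inv {s : ℝ} (hs : 1 < s) (k : ℕ) :
    armRatio (s + 1 / s) k =
      s * ((s ^ 2) ^ k - 1) / ((s ^ 2) ^ (k + 1) - 1) := by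
  have hs0 : 0 < s := by linarith
  have hpos : ∀ n, (s ^ 2) ^ (n + 1) - 1 > 0 := fun n => by
    have : 1 < (s ^ 2) ^ (n + 1) := one_lt_pow₀ (one_lt_pow₀ hs two_ne_zero) n.succ_ne_zero
    linarith
  induction k with
  | zero => simp [armRatio]
  | succ k ih =>
    have h1 := hpos k
    have h2 := hpos (k + 1)
    have e : s + 1 / s - s * ((s ^ 2) ^ k - 1) / ((s ^ 2) ^ (k + 1) - 1) =
        ((s ^ 2) ^ (k + 2) - 1) / (s * ((s ^ 2) ^ (k + 1) - 1)) := by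
      field_simp
      ring
    rw [armRatio, ih, e, one_div_div]

theorem armRatio_sum_of_lehmer {s : ℝ} (hs : 1 < s) (h : aeval (s ^ 2) lehmerPoly = 0) :
    armRatio (s + 1 / s) 1 + armRatio (s + 1 / s) 2 + armRatio (s + 1 / s) 6 = s + 1 / s := by
  rw [aeval_lehmerPoly] at h
  have hs0 : 0 < s := by linarith
  have hpos : ∀ n, (s ^ 2) ^ (n + 1) - 1 > 0 := fun n => by
    have : 1 < (s ^ 2) ^ (n + 1) := one_lt_pow₀ (one_lt_pow₀ hs two_ne_zero) n.succ_ne_zero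
    linarith
  have h1 := hpos 1
  have h2 := hpos 2
  have h6 := hpos 6
  rw [armRatio_add_inv hs, armRatio_add_inv hs, armRatio_add_inv hs]
  simp only [Nat.reduceAdd] at h1 h2 h6 ⊢
  have e : s + 1 / s = s * (s ^ 2 + 1) / s ^ 2 := by field_simp
  rw [e]
  generalize s ^ 2 = t at *
  have ht : 0 < t := by nlinarith
  rw [← sub_eq_zero]
  field_simp
  -- With denominators cleared, the difference of the two sides is Lehmer's polynomial in `t = s ^
  -- 2` times this factor.
  linear_combination -(s * (t - 1) ^ 3) * h

end Lehmer

end GraphMahler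

/-! ### Passage to induced subgraphs, components and isomorphic graphs. -/

namespace GraphMahler

open Polynomial
open scoped Classical

section Transfer

variable {V W : Type*} [Fintype V] [Fintype W] {G : SimpleGraph V} {H : SimpleGraph W}

theorem adjForm_extend (e : H ↪g G) (x : W → ℝ) :
    adjForm G (Function.extend e x 0) = adjForm H x := by
  have hout : ∀ v, v ∉ Set.range e → Function.extend e x 0 v = 0 := fun v hv =>
    Function.extend_apply' _ _ _ hv
  have hin : ∀ w, Function.extend e x 0 (e w) = x w := fun w => e.injective.extend_apply _ _ _
  refine (Fintype.sum_of_injective e e.injective _ _ (fun v hv => ?_) fun u => ?_).symm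
  · exact Finset.sum_eq_zero fun w _ => by rw [hout v hv]; simp
  · refine Fintype.sum_of_injective e e.injective _ _ (fun v hv => ?_) fun v => ?_
    · rw [hout v hv]; simp
    · simp only [hin, e.map_adj_iff]

theorem sum_sq_extend (e : H ↪g G) (x : W → ℝ) :
    ∑ v, Function.extend e x 0 v ^ 2 = ∑ w, x w ^ 2 := by
  refine (Fintype.sum_of_injective e e.injective _ _ (fun v hv => ?_) fun u => ?_).symm
  · rw [Function.extend_apply' _ _ _ hv]; simp
  · rw [e.injective.extend_apply]

omit [Fintype V] [Fintype W] in
theorem extend_ne_zero (e : H ↪g G) {x : W → ℝ} (hx : x ≠ 0) : Function.extend e x 0 ≠ 0 := by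
  obtain ⟨w, hw⟩ := Function.ne_iff.mp hx
  refine Function.ne_iff.mpr ⟨e w, ?_⟩
  rwa [e.injective.extend_apply]

theorem EigGe.of_embedding (e : H ↪g G) {l : ℝ} (h : EigGe H l) : EigGe G l := by
  obtain ⟨x, hx, hle⟩ := h
  exact ⟨_, extend_ne_zero e hx, by rwa [sum_sq_extend, adjForm_extend]⟩

theorem EigLeNeg.of_embedding (e : H ↪g G) {l : ℝ} (h : EigLeNeg H l) : EigLeNeg G l := by
  obtain ⟨x, hx, hle⟩ := h
  exact ⟨_, extend_ne_zero e hx, by rwa [sum_sq_extend, adjForm_extend]⟩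

theorem mahler_eq_of_iso (e : G ≃g H) : mahler G = mahler H := by
  have h1 : charPoly G = (G.adjMatrix ℤ).charpoly := by unfold charPoly; congr!
  have h2 : charPoly H = (H.adjMatrix ℤ).charpoly := by unfold charPoly; congr!
  have h3 : Matrix.reindex e.toEquiv e.toEquiv (G.adjMatrix ℤ) = H.adjMatrix ℤ := by
    ext i j
    have : G.Adj (e.symm i) (e.symm j) ↔ H.Adj i j := e.symm.map_rel_iff
    simp only [Matrix.reindex_apply, Matrix.submatrix_apply, SimpleGraph.adjMatrix_apply]
    change (if G.Adj (e.symm i) (e.symm j) then (1 : ℤ) else 0) = _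
    simp only [this]
  rw [mahler, mahler, Fintype.card_congr e.toEquiv, h1, h2, ← h3, Matrix.charpoly_reindex]

omit [Fintype W] in
-- The weights are glued: neighbours of a vertex lie in its own component, so the neighbour sums are
-- unchanged.
theorem superharmonic_of_components {l : ℝ}
    (h : ∀ C : G.ConnectedComponent, Superharmonic C.toSimpleGraph l) : Superharmonic G l := by
  choose w hw hle using h
  set f : V → ℝ := fun v => w (G.connectedComponentMk v) ⟨v, rfl⟩ with hf
  have hfC : ∀ (C : G.ConnectedComponent) (v : C), w C v = f v := by
    rintro C ⟨v, hv⟩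
    obtain rfl : G.connectedComponentMk v = C := hv
    rfl
  refine ⟨f, fun v => hw _ _, fun u => ?_⟩
  refine le_trans (le_of_eq ?_) (hle (G.connectedComponentMk u) ⟨u, rfl⟩)
  refine (Fintype.sum_of_injective (Subtype.val : G.connectedComponentMk u → V)
    Subtype.val_injective _ _ (fun v hv => if_neg fun huv => hv ⟨⟨v, ?_⟩, rfl⟩) fun v => ?_).symm
  · exact SimpleGraph.ConnectedComponent.sound huv.symm.reachable
  · rw [hfC]
    rfl

end Transfer

/-! ### Mahler measure of `T 1 2 6` and conclusion. -/

section CoxeterMahler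

theorem T_isBipartite (a b c : ℕ) : (T a b c).IsBipartite := by
  refine ⟨SimpleGraph.Coloring.mk (fun
    | none => (0 : Fin 2)
    | some ⟨_, k⟩ => Fin.ofNat 2 (k + 1)) ?_⟩
  rintro (_ | ⟨i, k⟩) (_ | ⟨j, m⟩) h
  · exact absurd h (SimpleGraph.irrefl _)
  · rw [T_adj_none_some] at h
    simp [h]
  · rw [SimpleGraph.adj_comm, T_adj_none_some] at h
    simp [h]
  · rw [T_adj_some_some] at h
    simp only [ne_eq, Fin.ext_iff, Fin.ofNat]
    omega

variable {τ : ℝ}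

theorem one_lt_sqrt_of_lehmer (hτ : 1 < τ) : 1 < √τ := by
  rw [Real.lt_sqrt zero_le_one]; simpa using hτ

theorem two_le_add_inv {s : ℝ} (hs : 0 < s) : 2 ≤ s + 1 / s := by
  have : s + 1 / s - 2 = (s - 1) ^ 2 / s := by field_simp; ring
  have : 0 ≤ (s - 1) ^ 2 / s := by positivity
  linarith

theorem T126_eigenvalues (hτ : 1 < τ) (h : aeval τ lehmerPoly = 0) :
    EigGe (T 1 2 6) (√τ + 1 / √τ) ∧ EigLeNeg (T 1 2 6) (√τ + 1 / √τ) := by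
  have hs := one_lt_sqrt_of_lehmer hτ
  have hsq : √τ ^ 2 = τ := Real.sq_sqrt (by linarith)
  have hge : EigGe (T 1 2 6) (√τ + 1 / √τ) :=
    (T_subharmonic (two_le_add_inv (by linarith)) (by norm_num) (by norm_num) (by norm_num)
      (armRatio_sum_of_lehmer hs (by rwa [hsq])).ge).eigGe
  exact ⟨hge, hge.eigLeNeg (T_isBipartite 1 2 6)⟩

theorem le_mahler_of_embedding {V : Type*} [Fintype V] {G : SimpleGraph V} (hτ : 1 < τ)
    (h : aeval τ lehmerPoly = 0) (e : T 1 2 6 ↪g G) : τ ≤ mahler G := by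
  have hs := one_lt_sqrt_of_lehmer hτ
  obtain ⟨h1, h2⟩ := T126_eigenvalues hτ h
  have := quadMahler_sq_le (by positivity) (h1.of_embedding e) (h2.of_embedding e)
  rwa [quadMahler_add_inv hs.le, Real.sq_sqrt (by linarith)] at this

/-- The ratios sum exactly to `l = √τ + 1 / √τ`, so the tree is both sub- and superharmonic at `l`.
The upper bound also uses that only the centre has more than two neighbours. -/
theorem mahler_T126 (hτ : 1 < τ) (h : aeval τ lehmerPoly = 0) : mahler (T 1 2 6) = τ := by
  have hs := one_lt_sqrt_of_lehmer hτ
  have hsq : √τ ^ 2 = τ := Real.sq_sqrt (by linarith)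
  refine le_antisymm ?_ (le_mahler_of_embedding hτ h SimpleGraph.Embedding.refl)
  have hsup : Superharmonic (T 1 2 6) (√τ + 1 / √τ) :=
    T_superharmonic (two_le_add_inv (by linarith)) (by norm_num) (by norm_num) (by norm_num)
      (armRatio_sum_of_lehmer hs (by rwa [hsq])).le
  have := hsup.mahler_le (o := none) fun u hu => T_adjSum_one_le hu
  rwa [quadMahler_add_inv hs.le, hsq] at this

theorem six_fifths_le_mahler {V : Type*} [Fintype V] {G : SimpleGraph V}
    (h : EigGe G (61 / 30)) : 6 / 5 ≤ mahler G := by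
  have h1 := h.quadMahler_le (by norm_num)
  have h2 := quadMahler_add_inv (s := 6 / 5) (by norm_num)
  norm_num at h2
  rwa [h2] at h1

theorem sq_le_mahler_of_eig {V : Type*} [Fintype V] {G : SimpleGraph V}
    (h : EigGe G (265 / 132)) (h' : EigLeNeg G (265 / 132)) : (12 / 11) ^ 2 ≤ mahler G := by
  have h1 := quadMahler_sq_le (by norm_num) h h'
  have h2 := quadMahler_add_inv (s := 12 / 11) (by norm_num)
  norm_num at h2
  rwa [h2] at h1

/-- One component that is not superharmonic at `2` suffices: its test vectors, extended by zero,
bound the eigenvalues of `G`. -/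
theorem mahler_eq_one_or_le {V : Type*} [Fintype V] (G : SimpleGraph V) (hτ : 1 < τ)
    (hτ' : τ < 1.18) (h : aeval τ lehmerPoly = 0) : mahler G = 1 ∨ τ ≤ mahler G := by
  by_cases hall : ∀ C : G.ConnectedComponent, Superharmonic C.toSimpleGraph 2
  · exact Or.inl (superharmonic_of_components hall).mahler_eq_one
  push Not at hall
  obtain ⟨C, hC⟩ := hall
  have e : C.toSimpleGraph ↪g G := SimpleGraph.Embedding.induce C.supp
  right
  rcases connected_cases C.connected_toSimpleGraph with h1 | h1 | ⟨h1, h2⟩ | ⟨⟨f⟩⟩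
  · exact absurd h1 hC
  · have := six_fifths_le_mahler (h1.of_embedding e)
    norm_num at hτ'
    linarith
  · have := sq_le_mahler_of_eig (h1.of_embedding e) (h2.of_embedding e)
    norm_num at hτ' this
    linarith
  · exact le_mahler_of_embedding hτ h (e.comp f.symm.toEmbedding)

theorem mahler_eq_iff {V : Type*} [Fintype V] {G : SimpleGraph V} (hG : G.Connected) (hτ : 1 < τ)
    (hτ' : τ < 1.18) (h : aeval τ lehmerPoly = 0) :
    mahler G = τ ↔ Nonempty (G ≃g T 1 2 6) := by
  constructor
  · intro hM
    norm_num at hτ'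
    rcases connected_cases hG with h1 | h1 | ⟨h1, h2⟩ | h1
    · have := h1.mahler_eq_one
      linarith
    · have := six_fifths_le_mahler h1
      linarith
    · have := sq_le_mahler_of_eig h1 h2
      norm_num at this
      linarith
    · exact h1
  · rintro ⟨e⟩
    rw [mahler_eq_of_iso e, mahler_T126 hτ h]

end CoxeterMahler

end GraphMahler

theorem mainTheorem4 :
    ∃ τ : ℝ,
      -- `τ` is Lehmer's number `τ₁ = 1.176280818…`
      IsGreatest {x : ℝ | Polynomial.aeval x GraphMahler.lehmerPoly = 0} τ ∧
      1.176280818 < τ ∧ τ < 1.176280819 ∧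
      -- the Mahler measure of a graph is `1` or at least `τ₁`
      (∀ (V : Type*) [Fintype V] (G : SimpleGraph V),
        GraphMahler.mahler G = 1 ∨ τ ≤ GraphMahler.mahler G) ∧
      -- among connected graphs, `τ₁` is attained, and only by `T(1, 2, 6) = E₁₀`
      (GraphMahler.T 1 2 6).Connected ∧
      GraphMahler.mahler (GraphMahler.T 1 2 6) = τ ∧
      (∀ (V : Type*) [Fintype V] (G : SimpleGraph V), G.Connected →
        (GraphMahler.mahler G = τ ↔ Nonempty (G ≃g GraphMahler.T 1 2 6))) ∧
      Nonempty (GraphMahler.T 1 2 6 ≃g GraphMahler.E 10) := by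
  obtain ⟨τ, hτ, h1, h2⟩ := GraphMahler.exists_isGreatest_lehmer
  have hlt : 1 < τ := by norm_num at h1; linarith
  have hlt' : τ < 1.18 := by norm_num at h2 ⊢; linarith
  have h0 : Polynomial.aeval τ GraphMahler.lehmerPoly = 0 := hτ.1
  exact ⟨τ, hτ, h1, h2, fun V _ G => GraphMahler.mahler_eq_one_or_le G hlt hlt' h0,
    GraphMahler.T_connected 1 2 6, GraphMahler.mahler_T126 hlt h0,
    fun V _ G hG => GraphMahler.mahler_eq_iff hG hlt hlt' h0, GraphMahler.nonempty_iso_E⟩
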